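/- Let $M$ be an $m$-dimensional connected, oriented and time-oriented globally hyperbolic spacetime with a compact spacelike Cauchy surface $i_\Sigma:\Sigma\to M$, and let $0\le k\le m$. Write $H^p_{\mathrm{free}}(X;\mathbb Z)$ for integral cohomology modulo torsion and $\mathbb T=\mathbb R/\mathbb Z$ (cohomology in negative degree is zero), and set $$\mathrm{Top}^k_{\mathrm{free}}(M)=\frac{H^{k-1}(M;\mathbb R)}{H^{k-1}_{\mathrm{free}}(M;\mathbb Z)}\oplus\frac{H^{m-k-1}(M;\mathbb R)}{H^{m-k-1}_{\mathrm{free}}(M;\mathbb Z)}\oplus H^k_{\mathrm{free}}(M;\mathbb Z)\oplus H^{m-k}_{\mathrm{free}}(M;\mathbb Z)\ni(u,\tilde u,z,\tilde z).$$ For $u\in H^p(\Sigma;\mathbb R)/H^p_{\mathrm{free}}(\Sigma;\mathbb Z)$ and $z\in H^{m-1-p}_{\mathrm{free}}(\Sigma;\mathbb Z)$ let $\langle u,z\rangle=(\mu u\smile\zeta)[\Sigma]\in\mathbb T$, where $\mu u\in H^p(\Sigma;\mathbb T)$ is the image of $u$ under the map induced by $\mathbb R\to\mathbb T$, $\zeta$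 is any integral class lifting $z$, and $[\Sigma]$ is the fundamental class. Equip $\mathrm{Top}^k_{\mathrm{free}}(M)$ with the antisymmetric bi-homomorphism $$\sigma_{\mathrm{free}}\big((u,\tilde u,z,\tilde z),(u',\tilde u',z',\tilde z')\big)=\langle i_\Sigma^*\tilde u,i_\Sigma^*z'\rangle-(-1)^{k(m-k)}\langle i_\Sigma^*u,i_\Sigma^*\tilde z'\rangle-\langle i_\Sigma^*\tilde u',i_\Sigma^*z\rangle+(-1)^{k(m-k)}\langle i_\Sigma^*u',i_\Sigma^*\tilde z\rangle .$$ Let $\mathcal W(\mathrm{Top}^k_{\mathrm{free}}(M))$ be its Weyl $C^*$-algebra: the enveloping $C^*$-algebra of the $\|\cdot\|_1$-completion of the unital $*$-algebra generated by symbols $W(g)$, $g\in\mathrm{Top}^k_{\mathrm{free}}(M)$, with relations $W(g)^*=W(-g)$ and $W(g)W(g')=e^{2\pi i\sigma_{\mathrm{free}}(g,g')}W(g+g')$, where $\|\sum_j\alpha_jW(g_j)\|_1=\sum_j|\alpha_j|$ for distinct $g_j$. Let $\mathcal W(\zeta_{\mathrm{free}}):\mathcal W(\mathrm{Top}^k_{\mathrm{free}}(M))\to\mathcal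 W(\mathrm{Top}^{m-k}_{\mathrm{free}}(M))$ be the $*$-homomorphism with $W(g)\mapsto W(\zeta_{\mathrm{free}}(g))$, where $\zeta_{\mathrm{free}}(u,\tilde u,z,\tilde z)=(\tilde u,(-1)^{k(m-k)+1}u,\tilde z,(-1)^{k(m-k)+1}z)$. Then there is a unique continuous linear functional $\omega_{\mathrm{free}}:\mathcal W(\mathrm{Top}^k_{\mathrm{free}}(M))\to\mathbb C$ with $$\omega_{\mathrm{free}}(W(u,\tilde u,z,\tilde z))=\begin{cases}1&\text{if }z=0\text{ and }\tilde z=0,\\0&\text{otherwise},\end{cases}$$ and it is a state (positive, with $\omega_{\mathrm{free}}(1)=1$). Moreover, this state on $\mathcal W(\mathrm{Top}^k_{\mathrm{free}}(M))$ and its analogue on $\mathcal W(\mathrm{Top}^{m-k}_{\mathrm{free}}(M))$ are compatible with the duality: $\omega_{\mathrm{free}}\circ\mathcal W(\zeta_{\mathrm{free}})=\omega_{\mathrm{free}}$. -/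

import Mathlib

open scoped Manifold ContDiff Topology

noncomputable section

/-! ## Singular homology and cohomology, cup product -/

namespace AbelianDuality

/-- The group `𝕋 = ℝ / ℤ`, written additively. -/
abbrev Torus : Type := AddCircle (1 : ℝ)

/-- The quotient homomorphism `ℝ → 𝕋`. -/
def toTorus : ℝ →+ Torus := QuotientAddGroup.mk' (AddSubgroup.zmultiples (1 : ℝ))

/-- The inclusion `ℤ → ℝ`. -/
def intToReal : ℤ →+ ℝ := Int.castAddHom ℝ

section Singular

variable {X Y Z : Type*} [TopologicalSpace X] [TopologicalSpace Y] [TopologicalSpace Z]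
variable {A B : Type*} [AddCommGroup A] [AddCommGroup B]

/-- Singular `p`-simplices of `X`: continuous maps from the standard simplex to `X`. -/
abbrev Simplex (X : Type*) [TopologicalSpace X] (p : ℕ) : Type _ :=
  C(stdSimplex ℝ (Fin (p + 1)), X)

/-- The affine map of standard simplices induced by a map of vertices. -/
def simplexMap {a b : ℕ} (f : Fin (a + 1) → Fin (b + 1)) :
    C(stdSimplex ℝ (Fin (a + 1)), stdSimplex ℝ (Fin (b + 1))) :=
  ⟨stdSimplex.map f, stdSimplex.continuous_map f⟩

/-- Precomposition of a singular simplex with an affine map given on vertices. -/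
def Simplex.restrict {a b : ℕ} (s : Simplex X b) (f : Fin (a + 1) → Fin (b + 1)) : Simplex X a :=
  s.comp (simplexMap f)

lemma Simplex.restrict_restrict {a b c : ℕ} (s : Simplex X c) (f : Fin (b + 1) → Fin (c + 1))
    (g : Fin (a + 1) → Fin (b + 1)) :
    Simplex.restrict (Simplex.restrict s f) g = Simplex.restrict s (f ∘ g) := by
  ext x
  simp only [Simplex.restrict, simplexMap, ContinuousMap.comp_apply, ContinuousMap.coe_mk,
    stdSimplex.map_comp_apply]

/-- The `i`-th face of a singular simplex. -/
def face {p : ℕ} (i : Fin (p + 2)) (s : Simplex X (p + 1)) : Simplex X p :=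
  Simplex.restrict s i.succAbove

/-- Singular chains with integer coefficients. -/
abbrev Chain (X : Type*) [TopologicalSpace X] (p : ℕ) : Type _ := Simplex X p →₀ ℤ

/-- The boundary `∂ s = ∑ i, (-1) ^ i • (i-th face of s)`. -/
def boundary (X : Type*) [TopologicalSpace X] (p : ℕ) : Chain X (p + 1) →+ Chain X p :=
  Finsupp.liftAddHom fun s =>
    ∑ i : Fin (p + 2), (Finsupp.singleAddHom (face i s)).comp
      (AddMonoidHom.mulLeft ((-1 : ℤ) ^ (i : ℕ)))

/-- Singular cycles; every `0`-chain is a cycle. -/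
def cycles (X : Type*) [TopologicalSpace X] : (p : ℕ) → AddSubgroup (Chain X p)
  | 0 => ⊤
  | p + 1 => (boundary X p).ker

/-- Singular homology `H_p(X; ℤ)`. -/
abbrev Homology (X : Type*) [TopologicalSpace X] (p : ℕ) : Type _ :=
  cycles X p ⧸ (boundary X p).range.addSubgroupOf (cycles X p)

/-- Singular cochains with coefficients in `A`. -/
abbrev Cochain (X : Type*) [TopologicalSpace X] (A : Type*) [AddCommGroup A] (p : ℕ) : Type _ :=
  Simplex X p → A

/-- The coboundary `(δ f) s = ∑ i, (-1) ^ i • f (i-th face of s)`. -/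
def coboundary (X : Type*) [TopologicalSpace X] (A : Type*) [AddCommGroup A] (p : ℕ) :
    Cochain X A p →+ Cochain X A (p + 1) where
  toFun f s := ∑ i : Fin (p + 2), (-1 : ℤ) ^ (i : ℕ) • f (face i s)
  map_zero' := by ext s; simp
  map_add' f g := by ext s; simp [Finset.sum_add_distrib]

/-- Singular cocycles. -/
def cocycles (X : Type*) [TopologicalSpace X] (A : Type*) [AddCommGroup A] (p : ℕ) :
    AddSubgroup (Cochain X A p) := (coboundary X A p).ker

/-- Singular coboundaries. -/
def coboundaries (X : Type*) [TopologicalSpace X] (A : Type*) [AddCommGroup A] :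
    (p : ℕ) → AddSubgroup (Cochain X A p)
  | 0 => ⊥
  | p + 1 => (coboundary X A p).range

/-- Singular cohomology `H^p(X; A)`. -/
abbrev Cohomology (X : Type*) [TopologicalSpace X] (A : Type*) [AddCommGroup A] (p : ℕ) : Type _ :=
  cocycles X A p ⧸ (coboundaries X A p).addSubgroupOf (cocycles X A p)

lemma mem_cocycles {p : ℕ} {f : Cochain X A p} :
    f ∈ cocycles X A p ↔ ∀ s, ∑ i : Fin (p + 2), (-1 : ℤ) ^ (i : ℕ) • f (face i s) = 0 :=
  funext_iff

/-- The homomorphism on cohomology induced by a homomorphism of cochain complexes. -/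
def cohomologyMap (φ : ∀ p : ℕ, Cochain X A p →+ Cochain Y B p)
    (hφ : ∀ p f, coboundary Y B p (φ p f) = φ (p + 1) (coboundary X A p f)) (p : ℕ) :
    Cohomology X A p →+ Cohomology Y B p :=
  QuotientAddGroup.map _ _
    (((φ p).comp (cocycles X A p).subtype).codRestrict (cocycles Y B p) (fun f => by
      have hf : coboundary X A p f.1 = 0 := f.2
      change coboundary Y B p (φ p f.1) = 0
      rw [hφ, hf, map_zero]))
    (by
      rintro ⟨f, hf⟩ h
      simp only [AddSubgroup.mem_addSubgroupOf] at h
      simp only [AddSubgroup.mem_comap, AddSubgroup.mem_addSubgroupOf]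
      change φ p f ∈ coboundaries Y B p
      change f ∈ coboundaries X A p at h
      cases p with
      | zero =>
        have h0 : f = 0 := h
        rw [h0, map_zero]; exact zero_mem _
      | succ p =>
        obtain ⟨e, rfl⟩ := h
        exact ⟨φ p e, hφ p e⟩)

/-- Pullback of cohomology classes along a continuous map. -/
def pullback (A : Type*) [AddCommGroup A] (i : C(X, Y)) (p : ℕ) :
    Cohomology Y A p →+ Cohomology X A p :=
  cohomologyMap (fun p =>
    { toFun := fun f s => f (i.comp s)
      map_zero' := rfl
      map_add' := fun _ _ => rfl }) (fun _ _ => rfl) p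

/-- Change of coefficients. -/
def coeffMap (X : Type*) [TopologicalSpace X] (φ : A →+ B) (p : ℕ) :
    Cohomology X A p →+ Cohomology X B p :=
  cohomologyMap (fun p =>
    { toFun := fun f s => φ (f s)
      map_zero' := by ext s; simp
      map_add' := fun _ _ => by ext s; simp }) (fun p f => by
        ext s
        simp [coboundary]) p

/-- Inclusion of the first `p + 1` vertices of the `n`-simplex, `n = p + q`. -/
def frontIncl {p q n : ℕ} (h : p + q = n) (j : Fin (p + 1)) : Fin (n + 1) := ⟨j, by omega⟩

/-- Inclusion of the last `q + 1` vertices of the `n`-simplex, `n = p + q`. -/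
def backIncl {p q n : ℕ} (h : p + q = n) (j : Fin (q + 1)) : Fin (n + 1) := ⟨p + j, by omega⟩

/-- The cup product of an `A`-valued and a `ℤ`-valued cochain: the value on a simplex is the
product of the values on its front `p`-face and on its back `q`-face. -/
def cupCochain (A : Type*) [AddCommGroup A] {p q n : ℕ} (h : p + q = n) :
    Cochain X A p →+ Cochain X ℤ q →+ Cochain X A n :=
  AddMonoidHom.mk' (fun f => AddMonoidHom.mk'
      (fun g s => g (Simplex.restrict s (backIncl h)) • f (Simplex.restrict s (frontIncl h)))
      (fun g g' => by ext s; simp [add_smul]))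
    (fun f f' => by ext g s; simp)

lemma coboundary_cup {p q n : ℕ} (h : p + q = n) (f : Cochain X A p) (g : Cochain X ℤ q) :
    coboundary X A n (cupCochain A h f g) =
      cupCochain A (by omega : (p + 1) + q = n + 1) (coboundary X A p f) g +
        (-1 : ℤ) ^ p • cupCochain A (by omega : p + (q + 1) = n + 1) f (coboundary X ℤ q g) := by
  subst h
  funext s
  have h1 : p + 1 + q = p + q + 1 := by omega
  have h2 : p + (q + 1) = p + q + 1 := rfl
  have h3 : p + 1 + (q + 1) = p + q + 2 := by omega
  -- faces with a small index are faces of the front part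
  have a1 : ∀ i : Fin (p + 1), Simplex.restrict (face (Fin.cast h3 (Fin.castAdd (q + 1) i)) s)
      (backIncl (rfl : p + q = p + q)) = Simplex.restrict s (backIncl h1) := by
    intro i
    rw [face, Simplex.restrict_restrict]
    congr 1; funext j; apply Fin.ext
    simp only [Function.comp, backIncl, Fin.succAbove, Fin.lt_def, Fin.val_castSucc, Fin.val_cast,
      Fin.val_castAdd]
    split_ifs <;> simp <;> omega
  have a2 : ∀ i : Fin (p + 1), Simplex.restrict (face (Fin.cast h3 (Fin.castAdd (q + 1) i)) s)
      (frontIncl (rfl : p + q = p + q)) = face i.castSucc (Simplex.restrict s (frontIncl h1)) := by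
    intro i
    rw [face, face, Simplex.restrict_restrict, Simplex.restrict_restrict]
    congr 1; funext j; apply Fin.ext
    simp only [Function.comp, frontIncl, Fin.succAbove, Fin.lt_def, Fin.val_castSucc, Fin.val_cast,
      Fin.val_castAdd]
    split_ifs <;> simp
  -- faces with a large index are faces of the back part
  have b1 : ∀ i : Fin (q + 1), Simplex.restrict (face (Fin.cast h3 (Fin.natAdd (p + 1) i)) s)
      (backIncl (rfl : p + q = p + q)) = face i.succ (Simplex.restrict s (backIncl h2)) := by
    intro i
    rw [face, face, Simplex.restrict_restrict, Simplex.restrict_restrict]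
    congr 1; funext j; apply Fin.ext
    simp only [Function.comp, backIncl, Fin.succAbove, Fin.lt_def, Fin.val_castSucc, Fin.val_cast,
      Fin.val_natAdd, Fin.val_succ]
    split_ifs <;> simp <;> omega
  have b2 : ∀ i : Fin (q + 1), Simplex.restrict (face (Fin.cast h3 (Fin.natAdd (p + 1) i)) s)
      (frontIncl (rfl : p + q = p + q)) = Simplex.restrict s (frontIncl h2) := by
    intro i
    rw [face, Simplex.restrict_restrict]
    congr 1; funext j; apply Fin.ext
    simp only [Function.comp, frontIncl, Fin.succAbove, Fin.lt_def, Fin.val_castSucc, Fin.val_cast,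
      Fin.val_natAdd]
    split_ifs <;> simp <;> omega
  -- the two remaining terms agree
  have c1 : face (Fin.last (p + 1)) (Simplex.restrict s (frontIncl h1)) =
      Simplex.restrict s (frontIncl h2) := by
    rw [face, Simplex.restrict_restrict]
    congr 1; funext j; apply Fin.ext
    simp [Function.comp, frontIncl]
  have c2 : face 0 (Simplex.restrict s (backIncl h2)) = Simplex.restrict s (backIncl h1) := by
    rw [face, Simplex.restrict_restrict]
    congr 1; funext j; apply Fin.ext
    simp [Function.comp, backIncl]; omega
  simp only [coboundary, cupCochain, AddMonoidHom.coe_mk, ZeroHom.coe_mk, AddMonoidHom.mk'_apply,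
    Pi.add_apply, Pi.smul_apply]
  rw [← (finCongr h3).sum_comp, Fin.sum_univ_add, Fin.sum_univ_castSucc (n := p + 1),
    Fin.sum_univ_succ (n := q + 1)]
  simp only [finCongr_apply, a1, a2, b1, b2, c1, c2, Fin.val_cast, Fin.val_castAdd, Fin.val_natAdd,
    Fin.val_castSucc, Fin.val_last, Fin.val_succ, Fin.val_zero, pow_add, pow_one, pow_zero,
    smul_add, add_smul, Finset.smul_sum, Finset.sum_smul, smul_smul, smul_eq_mul, mul_comm]
  simp [mul_assoc]

lemma cup_mem_cocycles {p q n : ℕ} (h : p + q = n) {f : Cochain X A p} {g : Cochain X ℤ q}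
    (hf : f ∈ cocycles X A p) (hg : g ∈ cocycles X ℤ q) :
    cupCochain A h f g ∈ cocycles X A n := by
  have hf' : coboundary X A p f = 0 := hf
  have hg' : coboundary X ℤ q g = 0 := hg
  change coboundary X A n _ = 0
  rw [coboundary_cup, hf', hg']
  simp

lemma cup_mem_coboundaries_left {p q n : ℕ} (h : p + q = n) {f : Cochain X A p} {g : Cochain X ℤ q}
    (hf : f ∈ coboundaries X A p) (hg : g ∈ cocycles X ℤ q) :
    cupCochain A h f g ∈ coboundaries X A n := by
  have hg' : coboundary X ℤ q g = 0 := hg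
  cases p with
  | zero =>
    have h0 : f = 0 := hf
    rw [h0, map_zero]; exact zero_mem _
  | succ p =>
    obtain ⟨e, rfl⟩ := hf
    obtain rfl : p + q + 1 = n := by omega
    refine ⟨cupCochain A rfl e g, ?_⟩
    rw [coboundary_cup, hg']
    simp

lemma cup_mem_coboundaries_right {p q n : ℕ} (h : p + q = n) {f : Cochain X A p}
    {g : Cochain X ℤ q} (hf : f ∈ cocycles X A p) (hg : g ∈ coboundaries X ℤ q) :
    cupCochain A h f g ∈ coboundaries X A n := by
  have hf' : coboundary X A p f = 0 := hf
  cases q with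
  | zero =>
    have h0 : g = 0 := hg
    rw [h0, map_zero]; exact zero_mem _
  | succ q =>
    obtain ⟨e, rfl⟩ := hg
    obtain rfl : p + q + 1 = n := by omega
    have key := coboundary_cup rfl f e
    rw [hf', map_zero, AddMonoidHom.zero_apply, zero_add] at key
    refine ⟨(-1 : ℤ) ^ p • cupCochain A rfl f e, ?_⟩
    rw [map_zsmul, key, smul_smul, ← mul_pow]
    simp

/-- The cup product `H^p(X; A) × H^q(X; ℤ) → H^n(X; A)`, `n = p + q`. -/
def cup (X : Type*) [TopologicalSpace X] (A : Type*) [AddCommGroup A] {p q n : ℕ}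
    (h : p + q = n) : Cohomology X A p →+ Cohomology X ℤ q →+ Cohomology X A n :=
  QuotientAddGroup.lift _
    (AddMonoidHom.mk' (fun f => QuotientAddGroup.lift _
        (AddMonoidHom.mk' (fun g => (QuotientAddGroup.mk
            ⟨cupCochain A h f.1 g.1, cup_mem_cocycles h f.2 g.2⟩ : Cohomology X A n))
          (fun g g' => by
            rw [← QuotientAddGroup.mk_add]; congr 1; ext1
            simp))
        (by
          intro g hg
          exact (QuotientAddGroup.eq_zero_iff _).2 (cup_mem_coboundaries_right h f.2 hg)))
      (fun f f' => by
        ext g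
        change (QuotientAddGroup.mk _ : Cohomology X A n) =
          QuotientAddGroup.mk _ + QuotientAddGroup.mk _
        rw [← QuotientAddGroup.mk_add]; congr 1; ext1
        simp))
    (by
      intro f hf
      ext g
      exact (QuotientAddGroup.eq_zero_iff _).2 (cup_mem_coboundaries_left h hf g.2))

/-- The value of a cochain on a chain. -/
def evalCochain (X : Type*) [TopologicalSpace X] (A : Type*) [AddCommGroup A] (p : ℕ) :
    Cochain X A p →+ Chain X p →+ A :=
  AddMonoidHom.mk' (fun f => Finsupp.liftAddHom fun s => (zmultiplesHom A) (f s))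
    (fun f f' => by ext s; simp)

lemma evalCochain_coboundary {p : ℕ} (f : Cochain X A p) (c : Chain X (p + 1)) :
    evalCochain X A (p + 1) (coboundary X A p f) c = evalCochain X A p f (boundary X p c) := by
  suffices h : evalCochain X A (p + 1) (coboundary X A p f) =
      (evalCochain X A p f).comp (boundary X p) from DFunLike.congr_fun h c
  ext s
  simp [evalCochain, coboundary, boundary]

/-- Evaluation `H^p(X; A) × H_p(X; ℤ) → A` of cohomology classes on homology classes. -/
def evalClass (X : Type*) [TopologicalSpace X] (A : Type*) [AddCommGroup A] (p : ℕ) :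
    Cohomology X A p →+ Homology X p →+ A :=
  QuotientAddGroup.lift _
    (AddMonoidHom.mk' (fun f => QuotientAddGroup.lift _
        ((evalCochain X A p f.1).comp (cycles X p).subtype)
        (by
          rintro ⟨z, hz⟩ ⟨b, hb⟩
          have hf : coboundary X A p f.1 = 0 := f.2
          have hb' : boundary X p b = z := hb
          change evalCochain X A p f.1 z = 0
          rw [← hb', ← evalCochain_coboundary, hf, map_zero, AddMonoidHom.zero_apply]))
      (fun f f' => by
        ext z
        change evalCochain X A p (f.1 + f'.1) z = evalCochain X A p f.1 z + evalCochain X A p f'.1 z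
        rw [map_add, AddMonoidHom.add_apply]))
    (by
      rintro ⟨f, hf⟩ h
      ext ⟨z, hz⟩
      change evalCochain X A p f z = 0
      change f ∈ coboundaries X A p at h
      cases p with
      | zero =>
        have h0 : f = 0 := h
        rw [h0, map_zero, AddMonoidHom.zero_apply]
      | succ p =>
        obtain ⟨e, rfl⟩ := h
        have hz' : boundary X p z = 0 := hz
        rw [evalCochain_coboundary, hz', map_zero])

/-! ## The groups of the torsion-free topological sector -/

/-- `H^k_free(X; ℤ)`: integral cohomology modulo torsion. -/
abbrev FreeCohomology (X : Type*) [TopologicalSpace X] (k : ℕ) : Type _ :=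
  Cohomology X ℤ k ⧸ AddCommGroup.torsion (Cohomology X ℤ k)

/-- `H^p(X; ℝ) / H^p_free(X; ℤ)`, where `H^p_free(X; ℤ)` is embedded in `H^p(X; ℝ)` as the image
of `H^p(X; ℤ)`. -/
abbrev RealModInt (X : Type*) [TopologicalSpace X] (p : ℕ) : Type _ :=
  Cohomology X ℝ p ⧸ (coeffMap X intToReal p).range

/-- `H^{k-1}(X; ℝ) / H^{k-1}_free(X; ℤ)`; cohomology in degree `-1` vanishes. -/
def RealModIntPred (X : Type*) [TopologicalSpace X] : ℕ → Type _
  | 0 => PUnit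
  | p + 1 => RealModInt X p

instance (X : Type*) [TopologicalSpace X] : (k : ℕ) → AddCommGroup (RealModIntPred X k)
  | 0 => inferInstanceAs (AddCommGroup PUnit)
  | p + 1 => inferInstanceAs (AddCommGroup (RealModInt X p))

lemma coeffMap_toTorus_intToReal (p : ℕ) (z : Cohomology X ℤ p) :
    coeffMap X toTorus p (coeffMap X intToReal p z) = 0 := by
  obtain ⟨f, rfl⟩ := QuotientAddGroup.mk_surjective z
  change QuotientAddGroup.mk _ = _
  rw [← QuotientAddGroup.mk_zero]
  congr 1; ext1; funext s
  change toTorus (intToReal (f.1 s)) = 0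
  exact (QuotientAddGroup.eq_zero_iff _).2 ⟨f.1 s, by simp [intToReal]⟩

/-- The inclusion `H^p(X; ℝ) / H^p_free(X; ℤ) → H^p(X; 𝕋)` induced by `ℝ → 𝕋`. -/
def muMap (X : Type*) [TopologicalSpace X] (p : ℕ) : RealModInt X p →+ Cohomology X Torus p :=
  QuotientAddGroup.lift _ (coeffMap X toTorus p) (by
    rintro _ ⟨z, rfl⟩
    exact coeffMap_toTorus_intToReal p z)

lemma exists_nsmul_eq {p : ℕ} (u : RealModInt X p) {n : ℕ} (hn : 0 < n) :
    ∃ v : RealModInt X p, n • v = u := by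
  obtain ⟨r, rfl⟩ := QuotientAddGroup.mk_surjective u
  obtain ⟨⟨f, hf⟩, rfl⟩ := QuotientAddGroup.mk_surjective r
  have hn' : (n : ℝ) ≠ 0 := by positivity
  refine ⟨QuotientAddGroup.mk (QuotientAddGroup.mk
    ⟨fun s => (n : ℝ)⁻¹ * f s, mem_cocycles.2 fun s => ?_⟩), ?_⟩
  · have := mem_cocycles.1 hf s
    simp only [zsmul_eq_mul] at this ⊢
    simp only [mul_left_comm _ (n : ℝ)⁻¹, ← Finset.mul_sum, this, mul_zero]
  · change QuotientAddGroup.mk (QuotientAddGroup.mk _) = _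
    congr 2; ext1; funext s
    change n • ((n : ℝ)⁻¹ * f s) = f s
    rw [nsmul_eq_mul, ← mul_assoc, mul_inv_cancel₀ hn', one_mul]

/-- The pairing `⟨u, z⟩ = (μ u ⌣ ζ)[c]` of `H^p(X; ℝ) / H^p_free(X; ℤ)` and `H^q_free(X; ℤ)`
with values in `𝕋`, where `ζ` is any integral lift of `z`, and `c` is a homology class of
degree `n = p + q`. -/
def freePairing {p q n : ℕ} (h : p + q = n) (c : Homology X n) :
    RealModInt X p →+ FreeCohomology X q →+ Torus :=
  AddMonoidHom.mk' (fun u => QuotientAddGroup.lift _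
      (((AddMonoidHom.eval c).comp (evalClass X Torus n)).comp (cup X Torus h (muMap X p u)))
      (by
        intro ζ hζ
        obtain ⟨N, hN, hNζ⟩ := isOfFinAddOrder_iff_nsmul_eq_zero.1 hζ
        obtain ⟨v, rfl⟩ := exists_nsmul_eq u hN
        have : cup X Torus h (muMap X p (N • v)) ζ = 0 := by
          rw [map_nsmul, map_nsmul, AddMonoidHom.nsmul_apply, ← map_nsmul, hNζ, map_zero]
        change evalClass X Torus n (cup X Torus h (muMap X p (N • v)) ζ) c = 0
        rw [this, map_zero, AddMonoidHom.zero_apply]))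
    (fun u u' => by ext ζ; simp)

/-- The pairing of `H^{k-1}(X; ℝ) / H^{k-1}_free(X; ℤ)` and `H^l_free(X; ℤ)` for
`k + l = n + 1`, given a homology class of degree `n`. -/
def freePairingPred {n : ℕ} (c : Homology X n) : {k l : ℕ} → (k + l = n + 1) →
    (RealModIntPred X k →+ FreeCohomology X l →+ Torus)
  | 0, _, _ => 0
  | _ + 1, _, h => freePairing (by omega) c

/-- Pullback on `H^{k-1}(-; ℝ) / H^{k-1}_free(-; ℤ)`. -/
def pullbackRealModIntPred (i : C(X, Y)) : (k : ℕ) → (RealModIntPred Y k →+ RealModIntPred X k)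
  | 0 => 0
  | p + 1 => QuotientAddGroup.map _ _ (pullback ℝ i p) (by
      rintro _ ⟨z, rfl⟩
      refine ⟨pullback ℤ i p z, ?_⟩
      obtain ⟨f, rfl⟩ := QuotientAddGroup.mk_surjective z
      rfl)

/-- Pullback on `H^k_free(-; ℤ)`. -/
def pullbackFree (i : C(X, Y)) (k : ℕ) : FreeCohomology Y k →+ FreeCohomology X k :=
  QuotientAddGroup.map _ _ (pullback ℤ i k) (by
    intro ζ hζ
    exact AddMonoidHom.isOfFinAddOrder (pullback ℤ i k) hζ)

/-- The torsion-free topological sector in degree `k` on a space `X` with respect to the dimension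
`m = k + l`: quadruples `(u, ũ, z, z̃)` in
`H^{k-1}(X; ℝ) / H^{k-1}_free(X; ℤ) ⊕ H^{l-1}(X; ℝ) / H^{l-1}_free(X; ℤ) ⊕
  H^k_free(X; ℤ) ⊕ H^l_free(X; ℤ)`. -/
abbrev TopFree (X : Type*) [TopologicalSpace X] (k l : ℕ) : Type _ :=
  RealModIntPred X k × RealModIntPred X l × FreeCohomology X k × FreeCohomology X l

/-- Pullback on the torsion-free topological sector. -/
def pullbackTopFree (i : C(X, Y)) (k l : ℕ) : TopFree Y k l →+ TopFree X k l :=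
  (pullbackRealModIntPred i k).prodMap ((pullbackRealModIntPred i l).prodMap
    ((pullbackFree i k).prodMap (pullbackFree i l)))

/-- The duality `(u, ũ, z, z̃) ↦ (ũ, (-1)^(kl+1) u, z̃, (-1)^(kl+1) z)`. -/
def dualityFree (X : Type*) [TopologicalSpace X] (k l : ℕ) : TopFree X k l →+ TopFree X l k :=
  AddMonoidHom.mk' (fun x => (x.2.1, (-1 : ℤ) ^ (k * l + 1) • x.1,
    x.2.2.2, (-1 : ℤ) ^ (k * l + 1) • x.2.2.1)) (fun x y => by simp)

/-- A presymplectic form on an Abelian group: an antisymmetric bi-homomorphism with values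
in `𝕋`. -/
structure PresymplecticForm (G : Type*) [AddCommGroup G] where
  toHom : G →+ G →+ Torus
  antisymm : ∀ x y, toHom x y = -toHom y x

/-- The form
`σ((u, ũ, z, z̃), (u', ũ', z', z̃')) = ⟨ũ, z'⟩ - (-1)^(kl) ⟨u, z̃'⟩ - ⟨ũ', z⟩ + (-1)^(kl) ⟨u', z̃⟩`
on the torsion-free topological sector of `X`, given a homology class `c` of degree `n`,
where `k + l = n + 1`. -/
def sigmaFreeOn {n k l : ℕ} (h : k + l = n + 1) (c : Homology X n) :
    PresymplecticForm (TopFree X k l) where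
  toHom := AddMonoidHom.mk' (fun x => AddMonoidHom.mk' (fun y =>
        freePairingPred c (by omega : l + k = n + 1) x.2.1 y.2.2.1
          - (-1 : ℤ) ^ (k * l) • freePairingPred c h x.1 y.2.2.2
          - freePairingPred c (by omega : l + k = n + 1) y.2.1 x.2.2.1
          + (-1 : ℤ) ^ (k * l) • freePairingPred c h y.1 x.2.2.2)
      (fun y y' => by simp; abel))
    (fun x x' => by ext1 y; simp; abel)
  antisymm x y := by simp; abel

/-- Pullback of a presymplectic form along a homomorphism. -/
def PresymplecticForm.comap {G H : Type*} [AddCommGroup G] [AddCommGroup H]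
    (σ : PresymplecticForm H) (f : G →+ H) : PresymplecticForm G where
  toHom := (σ.toHom.comp f).compl₂ f
  antisymm x y := σ.antisymm (f x) (f y)

lemma pullbackTopFree_duality (i : C(X, Y)) (k l : ℕ) (x : TopFree Y k l) :
    pullbackTopFree i l k (dualityFree Y k l x) = dualityFree X k l (pullbackTopFree i k l x) := by
  simp [pullbackTopFree, dualityFree]

lemma sigmaFreeOn_duality {n k l : ℕ} (h : k + l = n + 1) (h' : l + k = n + 1) (c : Homology X n)
    (x y : TopFree X k l) :
    (sigmaFreeOn h' c).toHom (dualityFree X k l x) (dualityFree X k l y) =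
      (sigmaFreeOn h c).toHom x y := by
  have hs : (-1 : ℤ) ^ (k * l) * (-1 : ℤ) ^ (k * l) = 1 := by rw [← mul_pow]; simp
  simp only [sigmaFreeOn, dualityFree, AddMonoidHom.mk'_apply, map_zsmul, AddMonoidHom.zsmul_apply,
    pow_succ, mul_comm l k, smul_smul, mul_neg, mul_one, hs, neg_smul, one_smul, map_neg,
    AddMonoidHom.neg_apply, smul_neg]
  abel

end Singular

/-! ## Enveloping C*-algebras -/

section Completion

open UniformSpace

lemma uniformContinuous_star_aux (A : Type*) [SeminormedRing A] [StarRing A] [NormedStarGroup A] :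
    UniformContinuous (star : A → A) := star_isometry.uniformContinuous

variable (A : Type*) [SeminormedRing A] [NormedAlgebra ℂ A] [StarRing A] [StarModule ℂ A]
  [NormedStarGroup A]

/-- The completion of a normed algebra. -/
instance completionNormedAlgebra : NormedAlgebra ℂ (Completion A) where
  norm_smul_le := norm_smul_le

/-- The involution of a normed `*`-algebra, extended to its completion by continuity. -/
instance completionStarRing : StarRing (Completion A) where
  star := Completion.map star
  star_involutive a := by
    induction a using Completion.induction_on with
    | hp => exact isClosed_eq (Completion.continuous_map.comp Completion.continuous_map)
              continuous_id
    | ih a => simp [Completion.map_coe (uniformContinuous_star_aux A)]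
  star_mul a b := by
    induction a, b using Completion.induction_on₂ with
    | hp => exact isClosed_eq (by fun_prop) (by fun_prop)
    | ih a b =>
      simp only [← Completion.coe_mul, Completion.map_coe (uniformContinuous_star_aux A), star_mul]
  star_add a b := by
    induction a, b using Completion.induction_on₂ with
    | hp => exact isClosed_eq (by fun_prop) (by fun_prop)
    | ih a b =>
      simp only [← Completion.coe_add, Completion.map_coe (uniformContinuous_star_aux A), star_add]

lemma completion_star_coe (a : A) : star (a : Completion A) = ((star a : A) : Completion A) :=
  Completion.map_coe (uniformContinuous_star_aux A) a

lemma completion_continuous_star : Continuous (star : Completion A → Completion A) :=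
  Completion.continuous_map

instance completionStarModule : StarModule ℂ (Completion A) where
  star_smul c a := by
    induction a using Completion.induction_on with
    | hp => exact isClosed_eq ((completion_continuous_star A).comp (continuous_const_smul c))
              ((completion_continuous_star A).const_smul (star c))
    | ih a => simp only [← Completion.coe_smul, completion_star_coe, star_smul]

instance completionNormedStarGroup : NormedStarGroup (Completion A) where
  norm_star_le a := by
    induction a using Completion.induction_on with
    | hp => exact isClosed_le (continuous_norm.comp (completion_continuous_star A)) continuous_norm
    | ih a => rw [completion_star_coe, Completion.norm_coe, Completion.norm_coe, norm_star]

variable {A} in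
/-- A contractive `*`-homomorphism extends to the completions. -/
def completionMap {B : Type*} [SeminormedRing B] [NormedAlgebra ℂ B] [StarRing B] [StarModule ℂ B]
    [NormedStarGroup B] (f : A →⋆ₐ[ℂ] B) (hf : ∀ a, ‖f a‖ ≤ ‖a‖) :
    Completion A →⋆ₐ[ℂ] Completion B :=
  have hu : UniformContinuous f :=
    (AddMonoidHomClass.lipschitz_of_bound f 1 (by simpa using hf)).uniformContinuous
  { toFun := Completion.map f
    map_one' := by rw [← Completion.coe_one, Completion.map_coe hu, map_one, Completion.coe_one]
    map_mul' := fun a b => by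
      induction a, b using Completion.induction_on₂ with
      | hp => exact isClosed_eq (by fun_prop) (by fun_prop)
      | ih a b => simp only [← Completion.coe_mul, Completion.map_coe hu, map_mul]
    map_zero' := by rw [← Completion.coe_zero, Completion.map_coe hu, map_zero, Completion.coe_zero]
    map_add' := fun a b => by
      induction a, b using Completion.induction_on₂ with
      | hp => exact isClosed_eq (by fun_prop) (by fun_prop)
      | ih a b => simp only [← Completion.coe_add, Completion.map_coe hu, map_add]
    commutes' := fun c => by
      rw [Completion.algebraMap_def, Completion.algebraMap_def, Completion.map_coe hu,
        AlgHomClass.commutes]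
    map_star' := fun a => by
      induction a using Completion.induction_on with
      | hp => exact isClosed_eq (Completion.continuous_map.comp (completion_continuous_star A))
                ((completion_continuous_star B).comp Completion.continuous_map)
      | ih a => simp only [completion_star_coe, Completion.map_coe hu, map_star] }

variable {A} in
lemma completionMap_coe {B : Type*} [SeminormedRing B] [NormedAlgebra ℂ B] [StarRing B]
    [StarModule ℂ B] [NormedStarGroup B] (f : A →⋆ₐ[ℂ] B) (hf : ∀ a, ‖f a‖ ≤ ‖a‖) (a : A) :
    completionMap f hf (a : Completion A) = (f a : B) :=
  Completion.map_coe
    (AddMonoidHomClass.lipschitz_of_bound f 1 (by simpa using hf)).uniformContinuous a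

variable {A} in
lemma norm_completionMap_le {B : Type*} [SeminormedRing B] [NormedAlgebra ℂ B] [StarRing B]
    [StarModule ℂ B] [NormedStarGroup B] (f : A →⋆ₐ[ℂ] B) (hf : ∀ a, ‖f a‖ ≤ ‖a‖)
    (a : Completion A) : ‖completionMap f hf a‖ ≤ ‖a‖ := by
  induction a using Completion.induction_on with
  | hp => exact isClosed_le (continuous_norm.comp Completion.continuous_map) continuous_norm
  | ih a => rw [completionMap_coe, Completion.norm_coe, Completion.norm_coe]; exact hf a

end Completion

section Enveloping

open UniformSpace

/-- A C*-seminorm on a normed `*`-algebra, dominated by its norm (for a Banach `*`-algebra this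
domination is automatic). These are exactly the functions `b ↦ ‖π b‖` for the (contractive)
`*`-representations `π` on Hilbert spaces. -/
structure CStarSeminorm (B : Type*) [NormedRing B] [NormedAlgebra ℂ B] [StarRing B] extends
    Seminorm ℂ B where
  mul_le' : ∀ a b, toFun (a * b) ≤ toFun a * toFun b
  star_mul_self' : ∀ a, toFun (star a * a) = toFun a ^ 2
  le_norm' : ∀ a, toFun a ≤ ‖a‖

variable {B C : Type*} [NormedRing B] [NormedAlgebra ℂ B] [StarRing B]
  [NormedRing C] [NormedAlgebra ℂ C] [StarRing C]

namespace CStarSeminorm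

instance : FunLike (CStarSeminorm B) B ℝ where
  coe p := p.toFun
  coe_injective p q h := by
    rcases p with ⟨⟨⟨p, _⟩, _⟩, _⟩; rcases q with ⟨⟨⟨q, _⟩, _⟩, _⟩
    cases h; rfl

variable (p : CStarSeminorm B)

lemma nonneg (a : B) : 0 ≤ p a := apply_nonneg p.toSeminorm a
lemma add_le (a b : B) : p (a + b) ≤ p a + p b := map_add_le_add p.toSeminorm a b
lemma smul_eq (c : ℂ) (a : B) : p (c • a) = ‖c‖ * p a := map_smul_eq_mul p.toSeminorm c a
lemma mul_le (a b : B) : p (a * b) ≤ p a * p b := p.mul_le' a b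
lemma star_mul_self (a : B) : p (star a * a) = p a ^ 2 := p.star_mul_self' a
lemma le_norm (a : B) : p a ≤ ‖a‖ := p.le_norm' a

lemma le_star (a : B) : p a ≤ p (star a) := by
  have h := p.mul_le (star a) a
  rw [p.star_mul_self, sq] at h
  rcases (p.nonneg a).eq_or_lt with h0 | h0
  · rw [← h0]; exact p.nonneg _
  · exact le_of_mul_le_mul_right h h0

instance : Inhabited (CStarSeminorm B) where
  default := { (0 : Seminorm ℂ B) with
    mul_le' := fun a b => by change (0 : ℝ) ≤ 0 * 0; simp
    star_mul_self' := fun a => by change (0 : ℝ) = 0 ^ 2; simp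
    le_norm' := fun a => norm_nonneg a }

/-- Pullback of a C*-seminorm along a contractive `*`-homomorphism. -/
def comap (q : CStarSeminorm C) (f : B →⋆ₐ[ℂ] C) (hf : ∀ a, ‖f a‖ ≤ ‖a‖) : CStarSeminorm B :=
  { q.toSeminorm.comp f.toAlgHom.toLinearMap with
    mul_le' := fun a b => by
      change q (f (a * b)) ≤ q (f a) * q (f b)
      rw [map_mul]; exact q.mul_le _ _
    star_mul_self' := fun a => by
      change q (f (star a * a)) = q (f a) ^ 2
      rw [map_mul, map_star]; exact q.star_mul_self _
    le_norm' := fun a => (q.le_norm (f a)).trans (hf a) }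

end CStarSeminorm

variable [StarModule ℂ B] [NormedStarGroup B] [StarModule ℂ C] [NormedStarGroup C]

variable (B) in
/-- A copy of `B`, to be equipped with the largest C*-seminorm. -/
def PreEnveloping : Type _ := B

namespace PreEnveloping

instance : Ring (PreEnveloping B) := inferInstanceAs (Ring B)
instance : Algebra ℂ (PreEnveloping B) := inferInstanceAs (Algebra ℂ B)
instance : StarRing (PreEnveloping B) := inferInstanceAs (StarRing B)
instance : StarModule ℂ (PreEnveloping B) := inferInstanceAs (StarModule ℂ B)

/-- The identity map `B → PreEnveloping B`. -/
def of : B ≃⋆ₐ[ℂ] PreEnveloping B := StarAlgEquiv.refl ℂ B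

/-- The largest C*-seminorm: the supremum of all C*-seminorms. -/
instance : Norm (PreEnveloping B) where
  norm a := ⨆ p : CStarSeminorm B, p (of.symm a)

lemma bddAbove (b : B) : BddAbove (Set.range fun p : CStarSeminorm B => p b) :=
  ⟨‖b‖, by rintro _ ⟨p, rfl⟩; exact p.le_norm b⟩

lemma le_norm (p : CStarSeminorm B) (b : B) : p b ≤ ‖of b‖ := le_ciSup (bddAbove b) p

lemma norm_le {b : B} {r : ℝ} (h : ∀ p : CStarSeminorm B, p b ≤ r) : ‖of b‖ ≤ r := ciSup_le h

lemma norm_of_le (b : B) : ‖of b‖ ≤ ‖b‖ := norm_le fun p => p.le_norm b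

lemma norm_nonneg' (b : B) : 0 ≤ ‖of b‖ := (default : CStarSeminorm B).nonneg b |>.trans (le_norm _ b)

lemma core : SeminormedSpace.Core ℂ (PreEnveloping B) where
  norm_nonneg a := norm_nonneg' (of.symm a)
  norm_smul c a := by
    change (⨆ p : CStarSeminorm B, p (c • of.symm a)) = ‖c‖ * ⨆ p : CStarSeminorm B, p (of.symm a)
    rw [Real.mul_iSup_of_nonneg (_root_.norm_nonneg c)]
    exact iSup_congr fun p => p.smul_eq c _
  norm_triangle a b := norm_le (b := of.symm a + of.symm b) fun p =>
    (p.add_le _ _).trans (add_le_add (le_norm p _) (le_norm p _))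

instance : SeminormedAddCommGroup (PreEnveloping B) :=
  SeminormedAddCommGroup.ofCore core

instance : SeminormedRing (PreEnveloping B) where
  __ := (inferInstance : SeminormedAddCommGroup (PreEnveloping B))
  __ := (inferInstance : Ring (PreEnveloping B))
  norm_mul_le a b := norm_le (b := of.symm a * of.symm b) fun p =>
    (p.mul_le _ _).trans (mul_le_mul (le_norm p (of.symm a)) (le_norm p (of.symm b)) (p.nonneg _)
      (norm_nonneg' (of.symm a)))

instance : NormedAlgebra ℂ (PreEnveloping B) where
  norm_smul_le c a := (core.norm_smul c a).le

instance : NormedStarGroup (PreEnveloping B) where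
  norm_star_le a := norm_le (b := star (of.symm a)) fun p =>
    (p.le_star _).trans (by rw [star_star]; exact le_norm p _)

lemma norm_mul_self_le (a : PreEnveloping B) : ‖a‖ * ‖a‖ ≤ ‖star a * a‖ := by
  rw [← sq]
  refine (Real.le_sqrt (norm_nonneg _) (norm_nonneg _)).1
    (norm_le (b := of.symm a) fun p => Real.le_sqrt_of_sq_le ?_)
  rw [← p.star_mul_self]
  exact le_norm p _

end PreEnveloping

variable (B) in
/-- The enveloping C*-algebra of a (unital) Banach `*`-algebra `B`: the Hausdorff completion of `B`
with respect to its largest C*-seminorm, i.e. to the supremum of `‖π b‖` over all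
`*`-representations `π`. -/
abbrev EnvelopingCStar : Type _ := Completion (PreEnveloping B)

namespace EnvelopingCStar

instance : CStarRing (EnvelopingCStar B) where
  norm_mul_self_le a := by
    induction a using Completion.induction_on with
    | hp => exact isClosed_le (continuous_norm.mul continuous_norm)
              (continuous_norm.comp ((completion_continuous_star _).mul continuous_id))
    | ih a =>
      rw [completion_star_coe, ← Completion.coe_mul, Completion.norm_coe, Completion.norm_coe]
      exact PreEnveloping.norm_mul_self_le a

instance : CStarAlgebra (EnvelopingCStar B) where

/-- The canonical map of a Banach `*`-algebra to its enveloping C*-algebra. -/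
def of (b : B) : EnvelopingCStar B := ((PreEnveloping.of b : PreEnveloping B) : Completion _)

/-- Functoriality of the enveloping C*-algebra. -/
def map (f : B →⋆ₐ[ℂ] C) (hf : ∀ b, ‖f b‖ ≤ ‖b‖) : EnvelopingCStar B →⋆ₐ[ℂ] EnvelopingCStar C :=
  completionMap (A := PreEnveloping B) (B := PreEnveloping C) f fun b =>
    PreEnveloping.norm_le (b := f b) fun q => PreEnveloping.le_norm (q.comap f hf) b

lemma map_of (f : B →⋆ₐ[ℂ] C) (hf : ∀ b, ‖f b‖ ≤ ‖b‖) (b : B) : map f hf (of b) = of (f b) :=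
  completionMap_coe (A := PreEnveloping B) (B := PreEnveloping C) f _ b

end EnvelopingCStar

end Enveloping

/-! ## Weyl algebras of presymplectic Abelian groups -/

section Weyl

open UniformSpace

variable {G H : Type*} [AddCommGroup G] [AddCommGroup H]

/-- The phase `exp (2 π i σ(g, h))`. -/
def PresymplecticForm.phase (σ : PresymplecticForm G) (g h : G) : ℂ :=
  AddCircle.toCircle (σ.toHom g h)

namespace PresymplecticForm

variable (σ : PresymplecticForm G)

lemma phase_add_left (a b c : G) : σ.phase (a + b) c = σ.phase a c * σ.phase b c := by
  simp [phase, AddCircle.toCircle_add]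

lemma phase_add_right (a b c : G) : σ.phase a (b + c) = σ.phase a b * σ.phase a c := by
  simp [phase, AddCircle.toCircle_add]

@[simp] lemma phase_zero_left (a : G) : σ.phase 0 a = 1 := by simp [phase]

@[simp] lemma phase_zero_right (a : G) : σ.phase a 0 = 1 := by simp [phase]

@[simp] lemma norm_phase (a b : G) : ‖σ.phase a b‖ = 1 := Circle.norm_coe _

lemma star_phase (a b : G) : star (σ.phase a b) = σ.phase (-b) (-a) := by
  simp only [phase, map_neg, AddMonoidHom.neg_apply, neg_neg]
  rw [σ.antisymm b a, AddCircle.toCircle_neg, Circle.coe_inv_eq_conj]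
  rfl

end PresymplecticForm

/-- The `*`-algebra generated by symbols `W g`, `g ∈ G`, subject to the relations
`W g ^* = W (-g)` and `W g * W h = exp (2 π i σ(g, h)) W (g + h)`: the vector space with basis
`W g`, with the product and the involution determined by the relations. -/
def WeylStarAlgebra (_σ : PresymplecticForm G) : Type _ := G →₀ ℂ

namespace WeylStarAlgebra

variable {σ : PresymplecticForm G} {τ : PresymplecticForm H}

instance : AddCommGroup (WeylStarAlgebra σ) := inferInstanceAs (AddCommGroup (G →₀ ℂ))
instance : Module ℂ (WeylStarAlgebra σ) := inferInstanceAs (Module ℂ (G →₀ ℂ))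

/-- The coefficients of an element with respect to the basis of the generators. -/
def coeffs (a : WeylStarAlgebra σ) : G →₀ ℂ := a

/-- The multiple `c • W g` of a generator. -/
def single (σ : PresymplecticForm G) (g : G) (c : ℂ) : WeylStarAlgebra σ := Finsupp.single g c

/-- The additive map determined by its values on the multiples of the generators. -/
def lift {N : Type*} [AddCommMonoid N] (f : G → ℂ →+ N) : WeylStarAlgebra σ →+ N :=
  (Finsupp.liftAddHom f : (G →₀ ℂ) →+ N)

lemma lift_single {N : Type*} [AddCommMonoid N] (f : G → ℂ →+ N) (g : G) (c : ℂ) :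
    lift f (single σ g c) = f g c := Finsupp.liftAddHom_apply_single f g c

lemma single_add (g : G) (c d : ℂ) : single σ g (c + d) = single σ g c + single σ g d :=
  Finsupp.single_add g c d

lemma single_zero (g : G) : single σ g 0 = 0 := Finsupp.single_zero g

lemma smul_single (g : G) (c d : ℂ) : c • single σ g d = single σ g (c * d) :=
  Finsupp.smul_single c g d

lemma induction {P : WeylStarAlgebra σ → Prop} (a : WeylStarAlgebra σ) (h0 : P 0)
    (h1 : ∀ g c, P (single σ g c)) (h2 : ∀ a b, P a → P b → P (a + b)) : P a :=
  Finsupp.induction_linear a h0 (fun a b => h2 a b) h1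

/-- The product, as a biadditive map. -/
def mulHom (σ : PresymplecticForm G) :
    WeylStarAlgebra σ →+ WeylStarAlgebra σ →+ WeylStarAlgebra σ :=
  lift fun g => AddMonoidHom.mk' (fun c => lift fun h => AddMonoidHom.mk'
      (fun d => single σ (g + h) (c * d * σ.phase g h))
      (fun d d' => by rw [← single_add]; congr 1; ring))
    (fun c c' => by
      refine DFunLike.ext _ _ fun a => ?_
      rw [AddMonoidHom.add_apply]
      induction a using induction with
      | h0 => simp
      | h1 h d =>
        simp only [lift_single, AddMonoidHom.mk'_apply]
        rw [← single_add]; congr 1; ring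
      | h2 a b ha hb => rw [map_add, map_add, map_add, ha, hb]; abel)

instance : Mul (WeylStarAlgebra σ) := ⟨fun a b => mulHom σ a b⟩
instance : One (WeylStarAlgebra σ) := ⟨single σ 0 1⟩

lemma mul_def (a b : WeylStarAlgebra σ) : a * b = mulHom σ a b := rfl

lemma one_def : (1 : WeylStarAlgebra σ) = single σ 0 1 := rfl

lemma single_mul_single (g h : G) (c d : ℂ) :
    single σ g c * single σ h d = single σ (g + h) (c * d * σ.phase g h) := by
  rw [mul_def, mulHom, lift_single, AddMonoidHom.mk'_apply, lift_single, AddMonoidHom.mk'_apply]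

private lemma add_mul_aux (a b c : WeylStarAlgebra σ) : (a + b) * c = a * c + b * c := by
  simp only [mul_def, map_add, AddMonoidHom.add_apply]

private lemma mul_add_aux (a b c : WeylStarAlgebra σ) : a * (b + c) = a * b + a * c := by
  simp only [mul_def, map_add]

private lemma zero_mul_aux (a : WeylStarAlgebra σ) : 0 * a = 0 := by
  simp only [mul_def, map_zero, AddMonoidHom.zero_apply]

private lemma mul_zero_aux (a : WeylStarAlgebra σ) : a * 0 = 0 := by
  simp only [mul_def, map_zero]

instance : Ring (WeylStarAlgebra σ) where
  __ := (inferInstance : AddCommGroup (WeylStarAlgebra σ))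
  left_distrib := mul_add_aux
  right_distrib := add_mul_aux
  zero_mul := zero_mul_aux
  mul_zero := mul_zero_aux
  mul_assoc a b c := by
    induction a using induction with
    | h0 => simp only [zero_mul_aux]
    | h2 a a' h h' => simp only [add_mul_aux, h, h']
    | h1 g x =>
      induction b using induction with
      | h0 => simp only [zero_mul_aux, mul_zero_aux]
      | h2 b b' h h' => simp only [add_mul_aux, mul_add_aux, h, h']
      | h1 g' y =>
        induction c using induction with
        | h0 => simp only [mul_zero_aux]
        | h2 c c' h h' => simp only [mul_add_aux, h, h']
        | h1 g'' z =>
          simp only [single_mul_single, σ.phase_add_left, σ.phase_add_right, add_assoc]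
          congr 1; ring
  one_mul a := by
    induction a using induction with
    | h0 => exact mul_zero_aux _
    | h2 a a' h h' => rw [mul_add_aux, h, h']
    | h1 g x => rw [one_def, single_mul_single]; simp
  mul_one a := by
    induction a using induction with
    | h0 => exact zero_mul_aux _
    | h2 a a' h h' => rw [add_mul_aux, h, h']
    | h1 g x => rw [one_def, single_mul_single]; simp

instance : Algebra ℂ (WeylStarAlgebra σ) :=
  Algebra.ofModule
    (fun r a b => by
      induction a using induction with
      | h0 => simp
      | h2 a a' h h' => simp only [smul_add, add_mul, h, h']
      | h1 g x =>
        induction b using induction with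
        | h0 => simp
        | h2 b b' h h' => simp only [smul_add, mul_add, h, h']
        | h1 g' y =>
          simp only [smul_single, single_mul_single]
          congr 1; ring)
    (fun r a b => by
      induction a using induction with
      | h0 => simp
      | h2 a a' h h' => simp only [smul_add, add_mul, h, h']
      | h1 g x =>
        induction b using induction with
        | h0 => simp
        | h2 b b' h h' => simp only [smul_add, mul_add, h, h']
        | h1 g' y =>
          simp only [smul_single, single_mul_single]
          congr 1; ring)

/-- The involution, as an additive map. -/
def starHom (σ : PresymplecticForm G) : WeylStarAlgebra σ →+ WeylStarAlgebra σ :=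
  lift fun g => AddMonoidHom.mk' (fun c => single σ (-g) (star c))
    (fun c d => by rw [star_add, single_add])

instance : Star (WeylStarAlgebra σ) := ⟨starHom σ⟩

lemma star_def (a : WeylStarAlgebra σ) : star a = starHom σ a := rfl

lemma star_single (g : G) (c : ℂ) : star (single σ g c) = single σ (-g) (star c) := by
  rw [star_def, starHom, lift_single, AddMonoidHom.mk'_apply]

private lemma star_add_aux (a b : WeylStarAlgebra σ) : star (a + b) = star a + star b := by
  simp only [star_def, map_add]

private lemma star_zero_aux : star (0 : WeylStarAlgebra σ) = 0 := by
  simp only [star_def, map_zero]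

instance : StarRing (WeylStarAlgebra σ) where
  star_add := star_add_aux
  star_involutive a := by
    induction a using induction with
    | h0 => simp only [star_zero_aux]
    | h2 a a' h h' => simp only [star_add_aux, h, h']
    | h1 g x => simp only [star_single, neg_neg, star_star]
  star_mul a b := by
    induction a using induction with
    | h0 => simp only [zero_mul, mul_zero, star_zero_aux]
    | h2 a a' h h' => simp only [add_mul, mul_add, star_add_aux, h, h']
    | h1 g x =>
      induction b using induction with
      | h0 => simp only [zero_mul, mul_zero, star_zero_aux]
      | h2 b b' h h' => simp only [add_mul, mul_add, star_add_aux, h, h']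
      | h1 g' y =>
        simp only [star_single, single_mul_single, star_mul', σ.star_phase, neg_add]
        rw [add_comm (-g)]
        congr 1; ring

instance : StarModule ℂ (WeylStarAlgebra σ) where
  star_smul c a := by
    induction a using induction with
    | h0 => simp
    | h2 a a' h h' => simp only [smul_add, star_add, h, h']
    | h1 g x => simp only [smul_single, star_single, star_mul']

/-- The norm `‖∑ j, α j W (g j)‖₁ = ∑ j, |α j|` (for distinct `g j`). -/
instance : Norm (WeylStarAlgebra σ) := ⟨fun a => (coeffs a).sum fun _ c => ‖c‖⟩

lemma norm_def (a : WeylStarAlgebra σ) : ‖a‖ = (coeffs a).sum fun _ c => ‖c‖ := rfl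

lemma norm_single (g : G) (c : ℂ) : ‖single σ g c‖ = ‖c‖ :=
  Finsupp.sum_single_index (norm_zero (E := ℂ))

lemma norm_eq_sum (a : WeylStarAlgebra σ) {s : Finset G} (hs : (coeffs a).support ⊆ s) :
    ‖a‖ = ∑ g ∈ s, ‖coeffs a g‖ :=
  Finsupp.sum_of_support_subset _ hs _ fun _ _ => norm_zero

lemma core : NormedSpace.Core ℂ (WeylStarAlgebra σ) where
  norm_nonneg a := Finset.sum_nonneg fun _ _ => norm_nonneg _
  norm_smul c a := by
    rw [norm_eq_sum (c • a) (s := (coeffs a).support) Finsupp.support_smul,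
      norm_eq_sum a subset_rfl, Finset.mul_sum]
    exact Finset.sum_congr rfl fun g _ => norm_smul c (coeffs a g)
  norm_triangle a b := by
    classical
    rw [norm_eq_sum a (s := (coeffs a).support ∪ (coeffs b).support) Finset.subset_union_left,
      norm_eq_sum b (s := (coeffs a).support ∪ (coeffs b).support) Finset.subset_union_right,
      norm_eq_sum (a + b) (s := (coeffs a).support ∪ (coeffs b).support) Finsupp.support_add,
      ← Finset.sum_add_distrib]
    exact Finset.sum_le_sum fun g _ => norm_add_le (coeffs a g) (coeffs b g)
  norm_eq_zero_iff a := by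
    constructor
    · intro h
      have h' := (Finset.sum_eq_zero_iff_of_nonneg (fun _ _ => norm_nonneg _)).1 h
      refine Finsupp.ext fun g => ?_
      by_contra hg
      exact hg (norm_eq_zero.1 (h' g (Finsupp.mem_support_iff.2 hg)))
    · rintro rfl
      exact Finsupp.sum_zero_index

instance : NormedAddCommGroup (WeylStarAlgebra σ) := NormedAddCommGroup.ofCore core

/-- An estimate of an additive map that holds on generators holds everywhere. -/
lemma norm_le_of_single {E : Type*} [SeminormedAddCommGroup E] (f : WeylStarAlgebra σ →+ E) (r : ℝ)
    (hf : ∀ g c, ‖f (single σ g c)‖ ≤ r * ‖c‖) (a : WeylStarAlgebra σ) : ‖f a‖ ≤ r * ‖a‖ := by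
  have ha : a = ∑ g ∈ (coeffs a).support, single σ g (coeffs a g) :=
    (Finsupp.sum_single (coeffs a)).symm
  conv_lhs => rw [ha, map_sum]
  rw [norm_eq_sum a subset_rfl, Finset.mul_sum]
  exact (norm_sum_le _ _).trans (Finset.sum_le_sum fun g _ => hf g _)

instance : NormedRing (WeylStarAlgebra σ) where
  __ := (inferInstance : NormedAddCommGroup (WeylStarAlgebra σ))
  __ := (inferInstance : Ring (WeylStarAlgebra σ))
  norm_mul_le a b := by
    refine norm_le_of_single (mulHom σ a) ‖a‖ (fun h d => ?_) b
    rw [mul_comm]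
    refine norm_le_of_single ((mulHom σ).flip (single σ h d)) ‖d‖ (fun g c => ?_) a
    change ‖single σ g c * single σ h d‖ ≤ _
    rw [single_mul_single, norm_single, norm_mul, norm_mul, σ.norm_phase, mul_one, mul_comm]

instance : NormedAlgebra ℂ (WeylStarAlgebra σ) where
  norm_smul_le c a := (core.norm_smul c a).le

instance : NormedStarGroup (WeylStarAlgebra σ) where
  norm_star_le a := by
    have := norm_le_of_single (starHom σ) 1 (fun g c => by
      change ‖star (single σ g c)‖ ≤ _
      rw [star_single, norm_single, norm_star, one_mul]) a
    rwa [one_mul] at this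

/-- The additive map `W g ↦ W (f g)`. -/
def mapHom (σ : PresymplecticForm G) (τ : PresymplecticForm H) (f : G → H) :
    WeylStarAlgebra σ →+ WeylStarAlgebra τ :=
  lift fun g => AddMonoidHom.mk' (fun c => single τ (f g) c) (fun c d => single_add _ c d)

lemma mapHom_single (f : G → H) (g : G) (c : ℂ) :
    mapHom σ τ f (single σ g c) = single τ (f g) c := by
  rw [mapHom, lift_single, AddMonoidHom.mk'_apply]

/-- The `*`-homomorphism `W g ↦ W (f g)` induced by a homomorphism `f` that preserves the
presymplectic forms. -/
def map (f : G →+ H) (hf : ∀ g g', τ.toHom (f g) (f g') = σ.toHom g g') :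
    WeylStarAlgebra σ →⋆ₐ[ℂ] WeylStarAlgebra τ where
  toFun := mapHom σ τ f
  map_zero' := map_zero _
  map_add' := map_add _
  map_one' := by rw [one_def, mapHom_single, map_zero, one_def]
  map_mul' a b := by
    have hp : ∀ g g', τ.phase (f g) (f g') = σ.phase g g' := fun g g' => by
      rw [PresymplecticForm.phase, hf]; rfl
    induction a using induction with
    | h0 => simp only [zero_mul, map_zero]
    | h2 a a' h h' => simp only [add_mul, map_add, h, h']
    | h1 g x =>
      induction b using induction with
      | h0 => simp only [mul_zero, map_zero]
      | h2 b b' h h' => simp only [mul_add, map_add, h, h']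
      | h1 g' y => simp only [mapHom_single, single_mul_single, hp, map_add]
  commutes' c := by
    rw [Algebra.algebraMap_eq_smul_one, Algebra.algebraMap_eq_smul_one, one_def, smul_single,
      mapHom_single, map_zero, one_def, smul_single]
  map_star' a := by
    induction a using induction with
    | h0 => simp only [star_zero, map_zero]
    | h2 a a' h h' => simp only [star_add, map_add, h, h']
    | h1 g x => simp only [mapHom_single, star_single, map_neg]

lemma map_single (f : G →+ H) (hf : ∀ g g', τ.toHom (f g) (f g') = σ.toHom g g') (g : G) (c : ℂ) :
    map f hf (single σ g c) = single τ (f g) c :=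
  mapHom_single f g c

lemma norm_map_le (f : G →+ H) (hf : ∀ g g', τ.toHom (f g) (f g') = σ.toHom g g')
    (a : WeylStarAlgebra σ) : ‖map f hf a‖ ≤ ‖a‖ := by
  have := norm_le_of_single (mapHom σ τ f) 1
    (fun g c => by
      rw [mapHom_single, norm_single, one_mul]) a
  rwa [one_mul] at this

end WeylStarAlgebra

/-- The Banach `*`-algebra of a presymplectic group: the completion for the norm `‖·‖₁`. -/
abbrev WeylBanachAlgebra (σ : PresymplecticForm G) : Type _ := Completion (WeylStarAlgebra σ)

/-- The Weyl C*-algebra of a presymplectic group: the enveloping C*-algebra of its Banach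
`*`-algebra. -/
abbrev WeylCStarAlgebra (σ : PresymplecticForm G) : Type _ := EnvelopingCStar (WeylBanachAlgebra σ)

/-- The Weyl generator `W g` in the Weyl C*-algebra. -/
def weyl (σ : PresymplecticForm G) (g : G) : WeylCStarAlgebra σ :=
  EnvelopingCStar.of ((WeylStarAlgebra.single σ g 1 : WeylStarAlgebra σ) : WeylBanachAlgebra σ)

/-- The `*`-homomorphism of Weyl C*-algebras, `W g ↦ W (f g)`, induced by a homomorphism that
preserves the presymplectic forms. -/
def weylMap {σ : PresymplecticForm G} {τ : PresymplecticForm H} (f : G →+ H)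
    (hf : ∀ g g', τ.toHom (f g) (f g') = σ.toHom g g') :
    WeylCStarAlgebra σ →⋆ₐ[ℂ] WeylCStarAlgebra τ :=
  EnvelopingCStar.map
    (completionMap (WeylStarAlgebra.map f hf) (WeylStarAlgebra.norm_map_le f hf))
    (norm_completionMap_le _ _)

lemma weylMap_weyl {σ : PresymplecticForm G} {τ : PresymplecticForm H} (f : G →+ H)
    (hf : ∀ g g', τ.toHom (f g) (f g') = σ.toHom g g') (g : G) :
    weylMap f hf (weyl σ g) = weyl τ (f g) := by
  rw [weylMap, weyl, EnvelopingCStar.map_of, completionMap_coe, WeylStarAlgebra.map_single, weyl]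

/-- A state on a unital C*-algebra: a positive normalized (continuous) linear functional. -/
def IsState {W : Type*} [CStarAlgebra W] (φ : W →L[ℂ] ℂ) : Prop :=
  φ 1 = 1 ∧ ∀ a : W, 0 ≤ (φ (star a * a)).re ∧ (φ (star a * a)).im = 0

end Weyl

/-! ## Spacetimes and Cauchy surfaces -/

section Spacetime

variable {n : ℕ} {M : Type*} [TopologicalSpace M] [ChartedSpace (EuclideanSpace ℝ (Fin (n + 1))) M]
  [IsManifold (𝓡 (n + 1)) ∞ M]
variable {S : Type*} [TopologicalSpace S] [ChartedSpace (EuclideanSpace ℝ (Fin n)) S]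

/-- An oriented and time-oriented Lorentzian structure on an `(n + 1)`-dimensional smooth manifold.
The signature is `(-, +, …, +)`; the orientation is represented by a nowhere vanishing continuous
form of top degree, and the time-orientation by a smooth timelike vector field, which is
future-directed by definition. -/
structure Spacetime (n : ℕ) (M : Type*) [TopologicalSpace M]
    [ChartedSpace (EuclideanSpace ℝ (Fin (n + 1))) M] [IsManifold (𝓡 (n + 1)) ∞ M] where
  /-- the metric -/
  metric : ∀ x : M, TangentSpace (𝓡 (n + 1)) x →L[ℝ] TangentSpace (𝓡 (n + 1)) x →L[ℝ] ℝ
  metric_symm : ∀ x v w, metric x v w = metric x w v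
  metric_lorentzian : ∀ x, ∃ t, metric x t t < 0 ∧
    ∀ v, metric x t v = 0 → v ≠ 0 → 0 < metric x v v
  metric_smooth : ContMDiff (𝓡 (n + 1))
    ((𝓡 (n + 1)).prod 𝓘(ℝ, EuclideanSpace ℝ (Fin (n + 1)) →L[ℝ]
      EuclideanSpace ℝ (Fin (n + 1)) →L[ℝ] ℝ)) ∞
    (fun x => Bundle.TotalSpace.mk' (EuclideanSpace ℝ (Fin (n + 1)) →L[ℝ]
      EuclideanSpace ℝ (Fin (n + 1)) →L[ℝ] ℝ)
      (E := fun x : M => TangentSpace (𝓡 (n + 1)) x →L[ℝ] TangentSpace (𝓡 (n + 1)) x →L[ℝ] ℝ)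
      x (metric x))
  /-- the orientation form -/
  orientation : ∀ x : M, (TangentSpace (𝓡 (n + 1)) x) [⋀^Fin (n + 1)]→L[ℝ] ℝ
  orientation_ne_zero : ∀ x, orientation x ≠ 0
  orientation_continuous : ∀ (x₀ : M) (v : Fin (n + 1) → EuclideanSpace ℝ (Fin (n + 1))),
    ContinuousOn (fun x => orientation x fun j =>
        (trivializationAt (EuclideanSpace ℝ (Fin (n + 1)))
          (TangentSpace (𝓡 (n + 1)) : M → Type _) x₀).symmL ℝ x (v j))
      (trivializationAt (EuclideanSpace ℝ (Fin (n + 1)))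
        (TangentSpace (𝓡 (n + 1)) : M → Type _) x₀).baseSet
  /-- the future-directed timelike vector field -/
  future : ∀ x : M, TangentSpace (𝓡 (n + 1)) x
  future_timelike : ∀ x, metric x (future x) (future x) < 0
  future_smooth : ContMDiff (𝓡 (n + 1)) (𝓡 (n + 1)).tangent ∞
    (fun x => (⟨x, future x⟩ : TangentBundle (𝓡 (n + 1)) M))

/-- An inextendible timelike curve, parametrized by `ℝ`: a `C^1` curve with timelike velocity that
has no endpoint in the past or in the future. -/
structure Spacetime.IsInextendibleTimelikeCurve (g : Spacetime n M) (γ : ℝ → M) : Prop where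
  contMDiff : ContMDiff 𝓘(ℝ, ℝ) (𝓡 (n + 1)) 1 γ
  timelike : ∀ t, g.metric (γ t) (mfderiv 𝓘(ℝ, ℝ) (𝓡 (n + 1)) γ t (1 : ℝ))
    (mfderiv 𝓘(ℝ, ℝ) (𝓡 (n + 1)) γ t (1 : ℝ)) < 0
  no_future_endpoint : ¬ ∃ x, Filter.Tendsto γ Filter.atTop (𝓝 x)
  no_past_endpoint : ¬ ∃ x, Filter.Tendsto γ Filter.atBot (𝓝 x)

/-- A smooth embedding `ι : S → M` of an `n`-manifold as a spacelike Cauchy surface: the induced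
metric on `S` is positive definite, and each inextendible timelike curve meets the image of `ι`
exactly once. -/
structure SpacelikeCauchySurface (g : Spacetime n M) (S : Type*) [TopologicalSpace S]
    [ChartedSpace (EuclideanSpace ℝ (Fin n)) S] where
  /-- the embedding -/
  ι : S → M
  isSmoothEmbedding : Manifold.IsSmoothEmbedding (𝓡 n) (𝓡 (n + 1)) ∞ ι
  spacelike : ∀ (s : S) (v : TangentSpace (𝓡 n) s), v ≠ 0 →
    0 < g.metric (ι s) (mfderiv (𝓡 n) (𝓡 (n + 1)) ι s v) (mfderiv (𝓡 n) (𝓡 (n + 1)) ι s v)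
  existsUnique_mem_range : ∀ γ, g.IsInextendibleTimelikeCurve γ → ∃! t, γ t ∈ Set.range ι

namespace SpacelikeCauchySurface

variable {g : Spacetime n M} (C : SpacelikeCauchySurface g S)

/-- The embedding as a continuous map. -/
def incl : C(S, M) := ⟨C.ι, C.isSmoothEmbedding.isEmbedding.continuous⟩

/-- The orientation form induced on the Cauchy surface: the orientation form of `M` with the
future-directed normal direction inserted in the first slot. -/
def inducedOrientation (s : S) (w : Fin n → TangentSpace (𝓡 n) s) : ℝ :=
  g.orientation (C.ι s) (Fin.cons (α := fun _ => TangentSpace (𝓡 (n + 1)) (C.ι s))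
    (g.future (C.ι s)) fun j => mfderiv (𝓡 n) (𝓡 (n + 1)) C.ι s (w j))

/-- A homology class `c` of top degree on `S` is a fundamental class if at each point `s` it
restricts to the local orientation: whenever `τ` is a singular simplex which is affine in the chart
at `s`, with vertices `v`, and contains `s` in its interior, then modulo boundaries and chains
in `S \ {s}`, `c` is represented by `± τ`, where the sign tells whether `τ` is positively or
negatively oriented. -/
def IsFundamentalClass (c : Homology S n) : Prop :=
  ∀ (s : S) (τ : Simplex S n) (v : Fin (n + 1) → EuclideanSpace ℝ (Fin n))
    (w : Fin n → TangentSpace (𝓡 n) s),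
    (∀ t, τ t ∈ (chartAt (EuclideanSpace ℝ (Fin n)) s).source ∧
      chartAt (EuclideanSpace ℝ (Fin n)) s (τ t) = ∑ j, t j • v j) →
    chartAt (EuclideanSpace ℝ (Fin n)) s s ∈ interior (convexHull ℝ (Set.range v)) →
    (∀ j, mfderiv (𝓡 n) 𝓘(ℝ, EuclideanSpace ℝ (Fin n)) (chartAt (EuclideanSpace ℝ (Fin n)) s) s
      (w j) = v j.succ - v 0) →
    ∃ (z : cycles S n) (b : Chain S (n + 1)) (a : Chain S n),
      c = QuotientAddGroup.mk z ∧ (∀ ρ ∈ a.support, s ∉ Set.range ρ) ∧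
      (z : Chain S n) =
        Finsupp.single τ (SignType.sign (C.inducedOrientation s w) : ℤ) + boundary S n b + a

open Classical in
/-- The fundamental class `[S] ∈ H_n(S; ℤ)` of the (compact, connected, oriented) surface `S`: the
unique homology class which restricts to the local orientation at each point. -/
def fundamentalClass : Homology S n := Classical.epsilon C.IsFundamentalClass

/-- The presymplectic form `σ_free` on the torsion-free topological sector of `M` in degree `k`,
where `k + l = n + 1 = dim M`: the pullback to `M` of the form on the Cauchy surface. -/
def sigmaFree {k l : ℕ} (h : k + l = n + 1) : PresymplecticForm (TopFree M k l) :=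
  (sigmaFreeOn h C.fundamentalClass).comap (pullbackTopFree C.incl k l)

lemma sigmaFree_duality {k l : ℕ} (h : k + l = n + 1) (h' : l + k = n + 1) (x y : TopFree M k l) :
    (C.sigmaFree h').toHom (dualityFree M k l x) (dualityFree M k l y) =
      (C.sigmaFree h).toHom x y := by
  change (sigmaFreeOn h' C.fundamentalClass).toHom (pullbackTopFree C.incl l k _)
    (pullbackTopFree C.incl l k _) = _
  rw [pullbackTopFree_duality, pullbackTopFree_duality, sigmaFreeOn_duality h h']
  rfl

/-- The Weyl C*-algebra of the torsion-free topological sector `TopFree M k l`, `l = dim M - k`. -/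
abbrev WeylFree {k l : ℕ} (h : k + l = n + 1) : Type _ := WeylCStarAlgebra (C.sigmaFree h)

/-- The isomorphism of Weyl C*-algebras implementing the duality, `W x ↦ W (ζ x)`. -/
def weylDuality {k l : ℕ} (h : k + l = n + 1) (h' : l + k = n + 1) :
    C.WeylFree h →⋆ₐ[ℂ] C.WeylFree h' :=
  weylMap (dualityFree M k l) (C.sigmaFree_duality h h')

open Classical in
/-- The values of the functional `ω_free` on the generators: `1` if `z = 0` and `z̃ = 0`, and `0`
otherwise. -/
def IsFreeFunctional {k l : ℕ} (h : k + l = n + 1) (φ : C.WeylFree h →L[ℂ] ℂ) : Prop :=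
  ∀ (u : RealModIntPred M k) (u' : RealModIntPred M l) (z : FreeCohomology M k)
    (z' : FreeCohomology M l),
    φ (weyl (C.sigmaFree h) (u, u', z, z')) = if z = 0 ∧ z' = 0 then 1 else 0

end SpacelikeCauchySurface

end Spacetime

end AbelianDuality

end

/-! The form is split off an integral part. Let `P` send `(u, ũ, z, z̃)` to `(z, z̃)`, with values
in the discrete group `N` of pairs of free integral classes, and let `β(x, (z', z̃')) = ⟨ũ, z'⟩ -
(-1)^(kl) ⟨u, z̃'⟩`, computed after restriction to the Cauchy surface. Then `σ(x, y) = β(x, P y) -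
β(y, P x)`: the classes `(u, ũ)` act as momenta (characters of `N`), the classes `(z, z̃)` as
translations of `N`.

Any form of this shape has a Schrödinger representation on `ℓ²(N)`, `(U_x f)(y) = exp(2πi β(x, 2y -
P x)) f(y - P x)`. These operators satisfy the Weyl relations (`weylShift_mul`, `star_weylShift`)
and are contractions, so they extend through the `ℓ¹` completion and the enveloping C*-algebra to a
representation (`weylLift`). The vector state of the delta function at `0` is the functional sought:
`U_x` moves `δ_0` to the point `P x` up to a phase, so `⟨δ_0, U_x δ_0⟩` vanishes unless `P x = 0`,
and then the phase is `exp(2πi β(x, 0)) = 1`. Positivity, normalization and continuity come with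
being a vector state (`exists_isState_weyl_eq_indicator`).

Uniqueness holds because the generators span a dense subspace (`weyl_continuousLinearMap_ext`).
Duality swaps `z` and `z̃` up to a sign, so it preserves the condition `z = z̃ = 0`; the pulled-back
functional thus has the prescribed values, and uniqueness identifies it. -/

noncomputable section

namespace AbelianDuality

open UniformSpace

/-! ### Universal properties of the completion and of the enveloping C*-algebra. -/

section Lift

lemma completion_coe_smul {A : Type*} [SeminormedRing A] [NormedAlgebra ℂ A] (c : ℂ) (a : A) :
    ((c • a : A) : Completion A) = c • (a : Completion A) :=
  Completion.coe_smul c a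

/-- A contractive `*`-homomorphism into a C*-algebra extends to the completion. -/
def completionLift {A D : Type*} [SeminormedRing A] [NormedAlgebra ℂ A] [StarRing A]
    [StarModule ℂ A] [NormedStarGroup A] [CStarAlgebra D] (f : A →⋆ₐ[ℂ] D)
    (hf : ∀ a, ‖f a‖ ≤ ‖a‖) : Completion A →⋆ₐ[ℂ] D :=
  have hu : UniformContinuous f :=
    (AddMonoidHomClass.lipschitz_of_bound f 1 (by simpa using hf)).uniformContinuous
  { toFun := Completion.extension f
    map_one' := by rw [← Completion.coe_one, Completion.extension_coe hu, map_one]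
    map_mul' := fun a b => by
      induction a, b using Completion.induction_on₂ with
      | hp => exact isClosed_eq (Completion.continuous_extension.comp continuous_mul)
                ((Completion.continuous_extension.comp continuous_fst).mul
                  (Completion.continuous_extension.comp continuous_snd))
      | ih a b => simp only [← Completion.coe_mul, Completion.extension_coe hu, map_mul]
    map_zero' := by rw [← Completion.coe_zero, Completion.extension_coe hu, map_zero]
    map_add' := fun a b => by
      induction a, b using Completion.induction_on₂ with
      | hp => exact isClosed_eq (Completion.continuous_extension.comp continuous_add)
                ((Completion.continuous_extension.comp continuous_fst).add
                  (Completion.continuous_extension.comp continuous_snd))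
      | ih a b => simp only [← Completion.coe_add, Completion.extension_coe hu, map_add]
    commutes' := fun c => by
      rw [Completion.algebraMap_def, Completion.extension_coe hu, AlgHomClass.commutes]
    map_star' := fun a => by
      induction a using Completion.induction_on with
      | hp => exact isClosed_eq
                (Completion.continuous_extension.comp (completion_continuous_star A))
                (continuous_star.comp Completion.continuous_extension)
      | ih a => simp only [completion_star_coe, Completion.extension_coe hu, map_star] }

lemma completionLift_coe {A D : Type*} [SeminormedRing A] [NormedAlgebra ℂ A] [StarRing A]
    [StarModule ℂ A] [NormedStarGroup A] [CStarAlgebra D] (f : A →⋆ₐ[ℂ] D)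
    (hf : ∀ a, ‖f a‖ ≤ ‖a‖) (a : A) : completionLift f hf (a : Completion A) = f a :=
  Completion.extension_coe
    (AddMonoidHomClass.lipschitz_of_bound f 1 (by simpa using hf)).uniformContinuous a

lemma norm_completionLift_le {A D : Type*} [SeminormedRing A] [NormedAlgebra ℂ A] [StarRing A]
    [StarModule ℂ A] [NormedStarGroup A] [CStarAlgebra D] (f : A →⋆ₐ[ℂ] D)
    (hf : ∀ a, ‖f a‖ ≤ ‖a‖) (a : Completion A) : ‖completionLift f hf a‖ ≤ ‖a‖ := by
  induction a using Completion.induction_on with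
  | hp => exact isClosed_le (continuous_norm.comp Completion.continuous_extension) continuous_norm
  | ih a => rw [completionLift_coe, Completion.norm_coe]; exact hf a

variable {B D : Type*} [NormedRing B] [NormedAlgebra ℂ B] [StarRing B] [CStarAlgebra D]

/-- The C*-seminorm `b ↦ ‖f b‖` of a contractive `*`-homomorphism into a C*-algebra. -/
def CStarSeminorm.ofHom (f : B →⋆ₐ[ℂ] D) (hf : ∀ b, ‖f b‖ ≤ ‖b‖) : CStarSeminorm B :=
  { (normSeminorm ℂ D).comp f.toAlgHom.toLinearMap with
    mul_le' := fun a b => by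
      change ‖f (a * b)‖ ≤ ‖f a‖ * ‖f b‖
      rw [map_mul]; exact norm_mul_le _ _
    star_mul_self' := fun a => by
      change ‖f (star a * a)‖ = ‖f a‖ ^ 2
      rw [map_mul, map_star, CStarRing.norm_star_mul_self, sq]
    le_norm' := hf }

variable [StarModule ℂ B] [NormedStarGroup B]

/-- The universal property of the enveloping C*-algebra. -/
def EnvelopingCStar.lift (f : B →⋆ₐ[ℂ] D) (hf : ∀ b, ‖f b‖ ≤ ‖b‖) : EnvelopingCStar B →⋆ₐ[ℂ] D :=
  completionLift (A := PreEnveloping B) f fun b =>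
    -- The seminorm `b ↦ ‖f b‖` takes part in the supremum defining the largest C*-seminorm, so `f`
    -- is contractive for the latter and extends by continuity.
    PreEnveloping.le_norm (CStarSeminorm.ofHom f hf) b

lemma EnvelopingCStar.lift_of (f : B →⋆ₐ[ℂ] D) (hf : ∀ b, ‖f b‖ ≤ ‖b‖) (b : B) :
    EnvelopingCStar.lift f hf (EnvelopingCStar.of b) = f b :=
  completionLift_coe (A := PreEnveloping B) f _ b

/-- Each C*-seminorm is dominated by the norm of `B`, hence so is their supremum, and the canonical
map is 1-Lipschitz. This carries density from the `ℓ¹` completion over to the C*-algebra. -/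
lemma EnvelopingCStar.continuous_of :
    Continuous (EnvelopingCStar.of : B → EnvelopingCStar B) := by
  have h : LipschitzWith 1 (EnvelopingCStar.of : B → EnvelopingCStar B) :=
    LipschitzWith.of_dist_le_mul fun a b => by
      have := PreEnveloping.norm_of_le (a - b)
      rw [map_sub] at this
      rw [EnvelopingCStar.of, EnvelopingCStar.of, Completion.dist_eq, dist_eq_norm, dist_eq_norm]
      simpa using this
  exact h.continuous

end Lift

/-! ### Representations of the Weyl C*-algebra from the Weyl relations, and density of the
generators. -/

section WeylRep

variable {G : Type*} [AddCommGroup G] {σ : PresymplecticForm G}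

/-- The `*`-homomorphism determined by a family of elements of a C*-algebra that satisfies the
Weyl relations. -/
def WeylStarAlgebra.ofRelations {D : Type*} [CStarAlgebra D] (U : G → D) (h1 : U 0 = 1)
    (hm : ∀ g h, U g * U h = σ.phase g h • U (g + h)) (hs : ∀ g, star (U g) = U (-g)) :
    WeylStarAlgebra σ →⋆ₐ[ℂ] D :=
  let F : WeylStarAlgebra σ →+ D :=
    WeylStarAlgebra.lift fun g => AddMonoidHom.mk' (fun c => c • U g) fun c d => add_smul c d _
  have hF : ∀ g c, F (single σ g c) = c • U g := fun g c => by
    simp only [F]; rw [lift_single, AddMonoidHom.mk'_apply]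
  { toFun := F
    map_zero' := map_zero F
    map_add' := map_add F
    map_one' := by rw [one_def, hF, h1, one_smul]
    map_mul' := fun a b => by
      induction a using induction with
      | h0 => simp only [zero_mul, map_zero]
      | h2 a a' h h' => simp only [add_mul, map_add, h, h']
      | h1 g x =>
        induction b using induction with
        | h0 => simp only [mul_zero, map_zero]
        | h2 b b' h h' => simp only [mul_add, map_add, h, h']
        | h1 g' y =>
          rw [single_mul_single, hF, hF, hF, smul_mul_smul_comm, hm, smul_smul]
    commutes' := fun c => by
      rw [Algebra.algebraMap_eq_smul_one, Algebra.algebraMap_eq_smul_one, one_def, smul_single,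
        hF, h1, mul_one]
    map_star' := fun a => by
      induction a using induction with
      | h0 => simp only [star_zero, map_zero]
      | h2 a a' h h' => simp only [star_add, map_add, h, h']
      | h1 g x => rw [star_single, hF, hF, star_smul, hs] }

lemma WeylStarAlgebra.ofRelations_single {D : Type*} [CStarAlgebra D] (U : G → D) (h1 : U 0 = 1)
    (hm : ∀ g h, U g * U h = σ.phase g h • U (g + h)) (hs : ∀ g, star (U g) = U (-g))
    (g : G) (c : ℂ) : ofRelations U h1 hm hs (single σ g c) = c • U g :=
  lift_single _ g c

/-- The triangle inequality for a finite sum of terms `c • U g` with `‖U g‖ ≤ 1` gives exactly the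
`ℓ¹` norm as bound. -/
lemma WeylStarAlgebra.norm_ofRelations_le {D : Type*} [CStarAlgebra D] (U : G → D) (h1 : U 0 = 1)
    (hm : ∀ g h, U g * U h = σ.phase g h • U (g + h)) (hs : ∀ g, star (U g) = U (-g))
    (hn : ∀ g, ‖U g‖ ≤ 1) (a : WeylStarAlgebra σ) : ‖ofRelations U h1 hm hs a‖ ≤ ‖a‖ := by
  have := norm_le_of_single (ofRelations U h1 hm hs : WeylStarAlgebra σ →+ D) 1 (fun g c => by
    change ‖ofRelations U h1 hm hs (single σ g c)‖ ≤ _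
    rw [ofRelations_single, norm_smul, one_mul]
    exact mul_le_of_le_one_right (norm_nonneg c) (hn g)) a
  rwa [one_mul] at this

/-- The representation of the Weyl C*-algebra determined by a contractive family of elements of a
C*-algebra that satisfies the Weyl relations. -/
def weylLift {D : Type*} [CStarAlgebra D] (U : G → D) (h1 : U 0 = 1)
    (hm : ∀ g h, U g * U h = σ.phase g h • U (g + h)) (hs : ∀ g, star (U g) = U (-g))
    (hn : ∀ g, ‖U g‖ ≤ 1) : WeylCStarAlgebra σ →⋆ₐ[ℂ] D :=
  EnvelopingCStar.lift
    (completionLift _ (WeylStarAlgebra.norm_ofRelations_le U h1 hm hs hn))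
    (norm_completionLift_le _ _)

lemma weylLift_weyl {D : Type*} [CStarAlgebra D] (U : G → D) (h1 : U 0 = 1)
    (hm : ∀ g h, U g * U h = σ.phase g h • U (g + h)) (hs : ∀ g, star (U g) = U (-g))
    (hn : ∀ g, ‖U g‖ ≤ 1) (g : G) : weylLift U h1 hm hs hn (weyl σ g) = U g := by
  rw [weylLift, weyl, EnvelopingCStar.lift_of, completionLift_coe,
    WeylStarAlgebra.ofRelations_single, one_smul]

/-- The Weyl generators span a dense subspace. -/
lemma weyl_continuousLinearMap_ext {φ ψ : WeylCStarAlgebra σ →L[ℂ] ℂ}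
    (h : ∀ g, φ (weyl σ g) = ψ (weyl σ g)) : φ = ψ := by
  have key : ∀ a : WeylStarAlgebra σ, φ (EnvelopingCStar.of (a : WeylBanachAlgebra σ)) =
      ψ (EnvelopingCStar.of (a : WeylBanachAlgebra σ)) := fun a => by
    induction a using WeylStarAlgebra.induction with
    | h0 =>
      have h0 : EnvelopingCStar.of (((0 : WeylStarAlgebra σ) : WeylBanachAlgebra σ)) = 0 := by
        rw [Completion.coe_zero]; exact Completion.coe_zero
      rw [h0, map_zero, map_zero]
    | h1 g c =>
      have hc : EnvelopingCStar.of ((WeylStarAlgebra.single σ g c : WeylStarAlgebra σ) :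
          WeylBanachAlgebra σ) = c • weyl σ g := by
        rw [weyl, ← mul_one c, ← WeylStarAlgebra.smul_single, Completion.coe_smul, mul_one]
        exact completion_coe_smul (A := PreEnveloping (WeylBanachAlgebra σ)) c _
      rw [hc, map_smul, map_smul, h]
    | h2 a b ha hb =>
      have hab : EnvelopingCStar.of (((a + b : WeylStarAlgebra σ)) : WeylBanachAlgebra σ) =
          EnvelopingCStar.of (a : WeylBanachAlgebra σ) +
            EnvelopingCStar.of (b : WeylBanachAlgebra σ) := by
        rw [Completion.coe_add]; exact Completion.coe_add _ _
      rw [hab, map_add, map_add, ha, hb]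
  ext a
  -- Two completions are nested, so density is used twice: for the C*-norm here, and below for the
  -- `ℓ¹` norm, where the canonical map is continuous.
  induction a using Completion.induction_on with
  | hp => exact isClosed_eq φ.continuous ψ.continuous
  | ih a =>
    change φ (EnvelopingCStar.of (a : WeylBanachAlgebra σ)) =
      ψ (EnvelopingCStar.of (a : WeylBanachAlgebra σ))
    induction (a : WeylBanachAlgebra σ) using Completion.induction_on with
    | hp => exact isClosed_eq (φ.continuous.comp EnvelopingCStar.continuous_of)
              (ψ.continuous.comp EnvelopingCStar.continuous_of)
    | ih a => exact key a

end WeylRep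

/-! ### The Schrödinger representation on `ℓ²(N)` and its vector state. -/

section WeylShift

variable {G N : Type*} [AddCommGroup G] [AddCommGroup N]

/-- The phase `exp (2 π i β(g, 2 y - P g))` of the Schrödinger representation. -/
def shiftPhase (P : G →+ N) (β : G →+ N →+ Torus) (g : G) (y : N) : ℂ :=
  AddCircle.toCircle (β g (y + (y - P g)))

lemma norm_shiftPhase (P : G →+ N) (β : G →+ N →+ Torus) (g : G) (y : N) :
    ‖shiftPhase P β g y‖ = 1 := Circle.norm_coe _

/-- A unimodular phase leaves moduli unchanged, so only a translation of `N` remains. Both square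
summability and the isometry property reduce to invariance of sums under this bijection. -/
lemma norm_shiftPhase_mul_rpow (P : G →+ N) (β : G →+ N →+ Torus) (f : lp (fun _ : N => ℂ) 2)
    (g : G) (y : N) (r : ℝ) :
    ‖shiftPhase P β g y * f (y - P g)‖ ^ r = ‖f (Equiv.subRight (P g) y)‖ ^ r := by
  rw [norm_mul, norm_shiftPhase, one_mul, Equiv.subRight_apply]

lemma memℓp_shift (P : G →+ N) (β : G →+ N →+ Torus) (g : G) (f : lp (fun _ : N => ℂ) 2) :
    Memℓp (fun y => shiftPhase P β g y * f (y - P g)) 2 := by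
  have h2 : 0 < (2 : ENNReal).toReal := by norm_num
  rw [memℓp_gen_iff h2]
  simp only [norm_shiftPhase_mul_rpow]
  exact (Equiv.summable_iff (Equiv.subRight (P g))).2 ((memℓp_gen_iff h2).1 (lp.memℓp f))

/-- The operator `(U g f)(y) = exp (2 π i β(g, 2 y - P g)) f (y - P g)` on `ℓ²(N)`. -/
def weylShift (P : G →+ N) (β : G →+ N →+ Torus) (g : G) :
    lp (fun _ : N => ℂ) 2 →L[ℂ] lp (fun _ : N => ℂ) 2 :=
  LinearMap.mkContinuous
    { toFun := fun f => ⟨fun y => shiftPhase P β g y * f (y - P g), memℓp_shift P β g f⟩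
      map_add' := fun f f' => by ext y; exact mul_add _ _ _
      map_smul' := fun c f => by ext y; exact mul_left_comm _ _ _ }
    1 (fun f => by
      have h2 : 0 < (2 : ENNReal).toReal := by norm_num
      rw [one_mul]
      -- The bound `1` is attained: the operator is isometric, as seen by comparing squared norms
      -- and reindexing the sum.
      refine le_of_eq ((Real.rpow_left_inj (norm_nonneg _) (norm_nonneg _) h2.ne').1 ?_)
      rw [lp.norm_rpow_eq_tsum h2, lp.norm_rpow_eq_tsum h2,
        ← (Equiv.subRight (P g)).tsum_eq fun y => ‖f y‖ ^ (2 : ENNReal).toReal]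
      exact tsum_congr fun y => norm_shiftPhase_mul_rpow P β f g y _)

lemma weylShift_apply (P : G →+ N) (β : G →+ N →+ Torus) (g : G) (f : lp (fun _ : N => ℂ) 2)
    (y : N) : weylShift P β g f y = shiftPhase P β g y * f (y - P g) := rfl

lemma norm_weylShift_le (P : G →+ N) (β : G →+ N →+ Torus) (g : G) : ‖weylShift P β g‖ ≤ 1 :=
  LinearMap.mkContinuous_norm_le _ zero_le_one _

lemma weylShift_zero (P : G →+ N) (β : G →+ N →+ Torus) : weylShift P β 0 = 1 := by
  ext f y
  rw [weylShift_apply]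
  simp [shiftPhase]

/-- Both sides translate by `P g + P h`, so only the phases differ. The exponent on the left is
`β(g, 2y - P g) + β(h, 2y - 2 P g - P h)`; subtracting `β(g + h, 2y - P g - P h)` leaves `β(g, P h)
- β(h, P g)`, which is `σ(g, h)`. -/
lemma weylShift_mul {σ : PresymplecticForm G} {P : G →+ N} {β : G →+ N →+ Torus}
    (hσ : ∀ g h, σ.toHom g h = β g (P h) - β h (P g)) (g h : G) :
    weylShift P β g * weylShift P β h = σ.phase g h • weylShift P β (g + h) := by
  ext f y
  change shiftPhase P β g y * (shiftPhase P β h (y - P g) * f (y - P g - P h)) =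
    σ.phase g h * (shiftPhase P β (g + h) y * f (y - P (g + h)))
  rw [map_add, ← sub_sub, ← mul_assoc, ← mul_assoc]
  congr 1
  simp only [shiftPhase, PresymplecticForm.phase, ← Circle.coe_mul, ← AddCircle.toCircle_add, hσ,
    map_add, map_sub, AddMonoidHom.add_apply]
  congr 2
  abel

/-- The symmetric exponent `2y - P g`, the sum of the target point `y` and the source point `y - P
g`, is what makes this hold without an extra phase: exchanging the two points and replacing `g` by
`-g` negates the exponent. -/
lemma star_weylShift (P : G →+ N) (β : G →+ N →+ Torus) (g : G) :
    star (weylShift P β g) = weylShift P β (-g) := by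
  rw [ContinuousLinearMap.star_eq_adjoint, eq_comm, ContinuousLinearMap.eq_adjoint_iff]
  intro f f'
  -- Substituting `y - P g` for `y` in the left-hand sum lines up the arguments of `f` and `f'` on
  -- both sides.
  rw [lp.inner_eq_tsum, lp.inner_eq_tsum, ← (Equiv.subRight (P g)).tsum_eq]
  refine tsum_congr fun y => ?_
  rw [weylShift_apply, weylShift_apply, Equiv.subRight_apply, map_neg, sub_neg_eq_add,
    sub_add_cancel]
  have h : star (shiftPhase P β (-g) (y - P g)) = shiftPhase P β g y := by
    rw [shiftPhase, shiftPhase, map_neg, map_neg, AddMonoidHom.neg_apply, AddCircle.toCircle_neg,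
      Circle.coe_inv_eq_conj, sub_neg_eq_add, sub_add_cancel, add_comm]
    exact star_star _
  rw [← h]
  simp only [RCLike.inner_apply, map_mul, starRingEnd_apply]
  ring

variable {σ : PresymplecticForm G} {P : G →+ N} {β : G →+ N →+ Torus}

/-- The Schrödinger representation on `ℓ²(N)` of the Weyl C*-algebra of the form
`σ(g, h) = β(g, P h) - β(h, P g)`. -/
def schrodingerRep (hσ : ∀ g h, σ.toHom g h = β g (P h) - β h (P g)) :
    WeylCStarAlgebra σ →⋆ₐ[ℂ] (lp (fun _ : N => ℂ) 2 →L[ℂ] lp (fun _ : N => ℂ) 2) :=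
  weylLift (weylShift P β) (weylShift_zero P β) (weylShift_mul hσ) (star_weylShift P β)
    (norm_weylShift_le P β)

/-- A vector state of a representation. -/
lemma isState_vectorState {W K : Type*} [CStarAlgebra W] [NormedAddCommGroup K]
    [InnerProductSpace ℂ K] [CompleteSpace K] (π : W →⋆ₐ[ℂ] (K →L[ℂ] K)) {x : K} (hx : ‖x‖ = 1) :
    ∃ φ : W →L[ℂ] ℂ, IsState φ ∧ ∀ a, φ a = inner ℂ x (π a x) := by
  refine ⟨LinearMap.mkContinuous
    ((innerₛₗ ℂ x).comp ((ContinuousLinearMap.apply ℂ K x).toLinearMap.comp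
      π.toAlgHom.toLinearMap)) 1 fun a => ?_, ⟨?_, fun a => ?_⟩, fun a => rfl⟩
  · change ‖inner ℂ x (π a x)‖ ≤ _
    refine (norm_inner_le_norm _ _).trans ?_
    rw [hx, one_mul, one_mul]
    refine ((π a).le_opNorm x).trans ?_
    rw [hx, mul_one]
    -- A `*`-homomorphism between C*-algebras is automatically contractive.
    exact NonUnitalStarAlgHom.norm_apply_le π a
  · change inner ℂ x (π 1 x) = 1
    rw [map_one, one_apply_eq_self, inner_self_eq_norm_sq_to_K, hx]
    simp
  -- Positivity: moving `π(a)*` across the inner product turns the value at `a* a` into a squared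
  -- norm.
  · have h : inner ℂ x (π (star a * a) x) = ((‖π a x‖ ^ 2 : ℝ) : ℂ) := by
      rw [map_mul, map_star, mul_apply_eq_comp, ContinuousLinearMap.star_eq_adjoint,
        ContinuousLinearMap.adjoint_inner_right, inner_self_eq_norm_sq_to_K]
      simp
    change 0 ≤ (inner ℂ x (π (star a * a) x)).re ∧ (inner ℂ x (π (star a * a) x)).im = 0
    rw [h, Complex.ofReal_re, Complex.ofReal_im]
    exact ⟨by positivity, rfl⟩

open Classical in
/-- If `σ(g, h) = β(g, P h) - β(h, P g)`, then the indicator function of the kernel of `P` extends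
to a state of the Weyl C*-algebra. -/
lemma exists_isState_weyl_eq_indicator (hσ : ∀ g h, σ.toHom g h = β g (P h) - β h (P g)) :
    ∃ φ : WeylCStarAlgebra σ →L[ℂ] ℂ, IsState φ ∧
      ∀ g, φ (weyl σ g) = if P g = 0 then 1 else 0 := by
  -- The cyclic vector is the delta function at `0 : N`.
  have hx : ‖(lp.single 2 0 1 : lp (fun _ : N => ℂ) 2)‖ = 1 := by
    rw [lp.norm_single (by norm_num), norm_one]
  obtain ⟨φ, hφ, h⟩ := isState_vectorState (schrodingerRep hσ) hx
  refine ⟨φ, hφ, fun g => ?_⟩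
  -- Pairing with `δ_0` evaluates at `0`, so the value is the phase at `0` times `δ_0(-P g)`. If `P
  -- g = 0` the exponent is `β(g, 0) = 0`.
  rw [h, schrodingerRep, weylLift_weyl, lp.inner_single_left, weylShift_apply, zero_sub,
    lp.single_apply]
  split_ifs with hg
  · simp [shiftPhase, hg]
  · simp [hg]

end WeylShift

/-! ### Splitting `σ_free` into momentum and translation parts. -/

section Sector

variable {X Y : Type*} [TopologicalSpace X] [TopologicalSpace Y]

/-- The projection `(u, ũ, z, z̃) ↦ (z, z̃)`. -/
def TopFree.integral (X : Type*) [TopologicalSpace X] (k l : ℕ) :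
    TopFree X k l →+ FreeCohomology X k × FreeCohomology X l :=
  (AddMonoidHom.snd _ _).comp (AddMonoidHom.snd _ _)

/-- The pairing `⟨ũ, z'⟩ - (-1)^(kl) ⟨u, z̃'⟩` of `(u, ũ, z, z̃)` and `(z', z̃')`. -/
def sigmaFreeHalf {n k l : ℕ} (h : k + l = n + 1) (c : Homology X n) :
    TopFree X k l →+ FreeCohomology X k × FreeCohomology X l →+ Torus :=
  AddMonoidHom.mk' (fun x => AddMonoidHom.mk' (fun y =>
      freePairingPred c (by omega : l + k = n + 1) x.2.1 y.1
        - (-1 : ℤ) ^ (k * l) • freePairingPred c h x.1 y.2)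
      (fun y y' => by simp; abel))
    (fun x x' => by ext1 y; simp; abel)

/-- The four terms of the form pair off: two contain `(u, ũ)` of `x` and `(z', z̃')` of `y`, the
other two are the same expression with `x` and `y` exchanged and the opposite sign. -/
lemma sigmaFreeOn_eq_half {n k l : ℕ} (h : k + l = n + 1) (c : Homology X n)
    (x y : TopFree X k l) :
    (sigmaFreeOn h c).toHom x y = sigmaFreeHalf h c x (TopFree.integral X k l y) -
      sigmaFreeHalf h c y (TopFree.integral X k l x) := by
  simp [sigmaFreeOn, sigmaFreeHalf, TopFree.integral]
  abel

/-- The pairing on a space `Y`, pulled back along `i : X → Y`. -/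
def sigmaFreeHalfPullback (i : C(X, Y)) {n k l : ℕ} (h : k + l = n + 1) (c : Homology X n) :
    TopFree Y k l →+ FreeCohomology Y k × FreeCohomology Y l →+ Torus :=
  ((sigmaFreeHalf h c).comp (pullbackTopFree i k l)).compl₂
    ((pullbackFree i k).prodMap (pullbackFree i l))

/-- The restriction along `i` is absorbed into the pairing, while the projection keeps its values in
the cohomology of `Y`. Its kernel is therefore `z = z̃ = 0` on `Y` itself, and no injectivity of
restriction on cohomology has to be known. -/
lemma sigmaFreeOn_comap_eq_half (i : C(X, Y)) {n k l : ℕ} (h : k + l = n + 1) (c : Homology X n)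
    (x y : TopFree Y k l) :
    ((sigmaFreeOn h c).comap (pullbackTopFree i k l)).toHom x y =
      sigmaFreeHalfPullback i h c x (TopFree.integral Y k l y) -
        sigmaFreeHalfPullback i h c y (TopFree.integral Y k l x) :=
  sigmaFreeOn_eq_half h c _ _

end Sector

/-! ### The functional `ω_free`: existence, uniqueness and duality. -/

namespace SpacelikeCauchySurface

variable {n : ℕ} {M : Type*} [TopologicalSpace M] [ChartedSpace (EuclideanSpace ℝ (Fin (n + 1))) M]
  [IsManifold (𝓡 (n + 1)) ∞ M] {g : Spacetime n M}
  {S : Type*} [TopologicalSpace S] [ChartedSpace (EuclideanSpace ℝ (Fin n)) S]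
  {C : SpacelikeCauchySurface g S} {k l : ℕ}

lemma exists_isFreeFunctional_isState (C : SpacelikeCauchySurface g S) (h : k + l = n + 1) :
    ∃ φ : C.WeylFree h →L[ℂ] ℂ, C.IsFreeFunctional h φ ∧ IsState φ := by
  -- Here `N` is the group of pairs of free integral classes on the spacetime, and `P` is the
  -- projection to `(z, z̃)`.
  obtain ⟨φ, hφ, hw⟩ := exists_isState_weyl_eq_indicator (σ := C.sigmaFree h)
    (sigmaFreeOn_comap_eq_half C.incl h C.fundamentalClass)
  refine ⟨φ, fun u u' z z' => ?_, hφ⟩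
  rw [hw]
  by_cases hz : z = 0 ∧ z' = 0
  · rw [if_pos hz]; exact if_pos (Prod.mk_eq_zero.2 hz)
  · rw [if_neg hz]; exact if_neg (mt Prod.mk_eq_zero.1 hz)

lemma IsFreeFunctional.unique {h : k + l = n + 1} {φ ψ : C.WeylFree h →L[ℂ] ℂ}
    (hφ : C.IsFreeFunctional h φ) (hψ : C.IsFreeFunctional h ψ) : φ = ψ :=
  weyl_continuousLinearMap_ext fun ⟨u, u', z, z'⟩ => by rw [hφ, hψ]

/-- The functional is compatible with the duality. -/
lemma IsFreeFunctional.comp_weylDuality {h : k + l = n + 1} {h' : l + k = n + 1}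
    {φ' : C.WeylFree h' →L[ℂ] ℂ} (hφ' : C.IsFreeFunctional h' φ') :
    ∃ φ : C.WeylFree h →L[ℂ] ℂ, C.IsFreeFunctional h φ ∧
      ∀ a, φ a = φ' (C.weylDuality h h' a) := by
  let D : C.WeylFree h →L[ℂ] C.WeylFree h' :=
    LinearMap.mkContinuous (C.weylDuality h h').toAlgHom.toLinearMap 1 fun a => by
      rw [one_mul]; exact NonUnitalStarAlgHom.norm_apply_le (C.weylDuality h h') a
  refine ⟨φ'.comp D, fun u u' z z' => ?_, fun a => rfl⟩
  change φ' (C.weylDuality h h' (weyl (C.sigmaFree h) (u, u', z, z'))) = _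
  rw [weylDuality, weylMap_weyl]
  classical refine (hφ' _ _ _ _).trans (if_congr ?_ rfl rfl)
  -- The integral components of the dual element are `z̃` and `± z`; neither the swap nor the sign
  -- affects their joint vanishing.
  change z' = 0 ∧ (-1 : ℤ) ^ (k * l + 1) • z = 0 ↔ _
  rw [and_comm]
  refine and_congr_left' ?_
  rcases neg_one_pow_eq_or ℤ (k * l + 1) with hs | hs <;> simp [hs]

end SpacelikeCauchySurface

end AbelianDuality

end

theorem mainTheorem7 {n : ℕ} {M : Type*} [TopologicalSpace M] [T2Space M]
    [SecondCountableTopology M] [ConnectedSpace M]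
    [ChartedSpace (EuclideanSpace ℝ (Fin (n + 1))) M] [IsManifold (𝓡 (n + 1)) ∞ M]
    (g : AbelianDuality.Spacetime n M)
    {S : Type*} [TopologicalSpace S] [CompactSpace S]
    [ChartedSpace (EuclideanSpace ℝ (Fin n)) S] [IsManifold (𝓡 n) ∞ S]
    (C : AbelianDuality.SpacelikeCauchySurface g S) :
    (∀ (k l : ℕ) (h : k + l = n + 1),
      ∃ φ : C.WeylFree h →L[ℂ] ℂ, C.IsFreeFunctional h φ ∧ AbelianDuality.IsState φ ∧
        ∀ ψ : C.WeylFree h →L[ℂ] ℂ, C.IsFreeFunctional h ψ → ψ = φ) ∧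
    (∀ (k l : ℕ) (h : k + l = n + 1) (h' : l + k = n + 1)
      (φ : C.WeylFree h →L[ℂ] ℂ) (φ' : C.WeylFree h' →L[ℂ] ℂ),
      C.IsFreeFunctional h φ → C.IsFreeFunctional h' φ' →
        ∀ a : C.WeylFree h, φ' (C.weylDuality h h' a) = φ a) := by
  refine ⟨fun k l h => ?_, fun k l h h' φ φ' hφ hφ' a => ?_⟩
  · obtain ⟨φ, hφ, hs⟩ := C.exists_isFreeFunctional_isState h
    exact ⟨φ, hφ, hs, fun ψ hψ => hψ.unique hφ⟩
  -- `ψ` is the pullback of `φ'` along the duality. It has the values that characterize `φ`, so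
  -- uniqueness applies.
  · obtain ⟨ψ, hψ, hd⟩ := hφ'.comp_weylDuality (h := h)
    rw [← hd, hψ.unique hφ]
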